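/- Let $Y\subseteq\mathbb R^n$ be nonempty, closed, convex and bounded with diameter $D$, let $\ell>0$, and let $f:\mathbb R^m\times\mathbb R^n\to\mathbb R$ be $\ell$-smooth (differentiable with $\ell$-Lipschitz gradient, jointly in both variables) with $f(x,\cdot)$ concave on $Y$ for every $x$. Put $\Phi(x)=\max_{y\in Y}f(x,y)$ and $\Phi_{1/2\ell}(x)=\min_{w}\{\Phi(w)+\ell\|w-x\|^2\}$. A point $x\in\mathbb R^m$ is an $\epsilon$-stationary point of $\Phi$ if $\Phi_{1/2\ell}$ is differentiable at $x$ and $\|\nabla\Phi_{1/2\ell}(x)\|\le\epsilon$. A pair $(x,y)\in\mathbb R^m\times Y$ is an $\epsilon$-stationary point of $f$ if $\|\nabla_xf(x,y^+)\|\le\epsilon$ and $\|y^+-y\|\le\epsilon/\ell$, where $y^+=P_Y\bigl(y+\tfrac1\ell\nabla_yf(x,y)\bigr)$ and $P_Y$ is the orthogonal projection onto $Y$. A random pair $(x,y)$ with values in $\mathbb R^m\times Y$ is $\epsilon$-stationary for $f$ in expectation if $\mathbb E\|\nabla_xf(x,y^+)\|^2\le\epsilon^2$ and $\mathbb E\|y^+-y\|^2\le(\epsilon/\ell)^2$.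 A stochastic gradient of $f$ with variance at most $\sigma^2$ is a measurable map $G(x,y,\xi)$ of the point and of a random sample $\xi$ with $\mathbb E\,G(x,y,\xi)=\nabla f(x,y)$ and $\mathbb E\|G(x,y,\xi)-\nabla f(x,y)\|^2\le\sigma^2$ for all $(x,y)$. Below, a method is an adaptive rule that may depend on $m,n,\ell,Y,\epsilon,\hat x$ (and on $\sigma$ in part 2), but that learns about $f$ only through its gradient evaluations. There is an absolute constant $K$ such that the following hold for all such $m,n,\ell,Y$. 1. For all $\epsilon>0$ and $\hat x\in\mathbb R^m$ there is a method that makes at most $K\,\ell^2D^2\,\epsilon^{-2}$ gradient evaluations and that, for every $f$ as above for which $\hat x$ is an $\epsilon$-stationary point of $\Phi$, returns a $4\epsilon$-stationary point $(x',y')$ of $f$. In particular $O(\epsilon^{-2})$ gradient evaluations suffice for fixed $\ell$ and $D$. 2. For all $\sigma\ge0$, $\epsilon>0$ and $\hat x\in\mathbb R^m$ there is a (measurable) method that makes at most $K\,\ell^2D^2(\ell^2D^2+\sigma^2)\,\epsilon^{-4}$ stochastic gradient evaluations and that, for every $f$ as above for which $\hat x$ is an $\epsilon$-stationary point of $\Phi$,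 and for every stochastic gradient of $f$ with variance at most $\sigma^2$, queried with independent identically distributed samples, returns a random pair $(x',y')$ that is $4\epsilon$-stationary for $f$ in expectation. In particular $O(\epsilon^{-4})$ stochastic gradient evaluations suffice for fixed $\ell$, $D$ and $\sigma$. 3. Conversely, for every $f$ as above and every $\epsilon\ge0$, if $(\hat x,\hat y)$ is an $\frac{\epsilon^2}{\max\{1,\ell D\}}$-stationary point of $f$, then $\hat x$ is a $(4\epsilon^2+4\epsilon)$-stationary point of $\Phi$. -/

import Mathlib

open MeasureTheory ProbabilityTheory

/-- The Euclidean space `ℝᵐ`. -/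
abbrev Euc (m : ℕ) : Type := EuclideanSpace ℝ (Fin m)

/-- `∇ₓ f (x, y)`. -/
noncomputable def gradX {m n : ℕ} (f : Euc m → Euc n → ℝ) (x : Euc m) (y : Euc n) : Euc m :=
  gradient (fun x' => f x' y) x

/-- `∇_y f (x, y)`. -/
noncomputable def gradY {m n : ℕ} (f : Euc m → Euc n → ℝ) (x : Euc m) (y : Euc n) : Euc n :=
  gradient (f x) y

/-- The answer of the exact gradient oracle of `f` at the point `z = (x, y)`. -/
noncomputable def gradPair {m n : ℕ} (f : Euc m → Euc n → ℝ) (z : Euc m × Euc n) :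
    Euc m × Euc n :=
  (gradX f z.1 z.2, gradY f z.1 z.2)

/-- `g` is `ℓ`-smooth: differentiable, with an `ℓ`-Lipschitz gradient. -/
def IsSmoothWith {V : Type*} [NormedAddCommGroup V] [InnerProductSpace ℝ V] [CompleteSpace V]
    (ℓ : ℝ) (g : V → ℝ) : Prop :=
  Differentiable ℝ g ∧ ∀ z z' : V, ‖gradient g z - gradient g z'‖ ≤ ℓ * ‖z - z'‖

/-- `f : ℝᵐ × ℝⁿ → ℝ` is `ℓ`-smooth jointly in `(x, y)` for the Euclidean norm on `ℝᵐ × ℝⁿ`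
(`WithLp 2` selects this norm on the product), and `f (x, ·)` is concave on `Y` for every `x`. -/
structure IsSmoothConcave {m n : ℕ} (ℓ : ℝ) (Y : Set (Euc n)) (f : Euc m → Euc n → ℝ) : Prop where
  smooth : IsSmoothWith ℓ (fun z : WithLp 2 (Euc m × Euc n) => f z.fst z.snd)
  concave : ∀ x, ConcaveOn ℝ Y (f x)

/-- A constraint set: nonempty, closed, convex, bounded, of diameter `D`. -/
structure IsConstraintSet {n : ℕ} (D : ℝ) (Y : Set (Euc n)) : Prop where
  nonempty : Y.Nonempty
  closed : IsClosed Y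
  convex : Convex ℝ Y
  bounded : Bornology.IsBounded Y
  diam_eq : Metric.diam Y = D

/-- The orthogonal projection `P_Y z`: the point of `Y` nearest to `z`
(for `Y` nonempty, closed and convex, see `projSet_eq_iff`). -/
noncomputable def projSet {n : ℕ} (Y : Set (Euc n)) (z : Euc n) : Euc n :=
  Classical.epsilon fun p => p ∈ Y ∧ ∀ q ∈ Y, ‖z - p‖ ≤ ‖z - q‖

theorem projSet_spec {n : ℕ} {Y : Set (Euc n)} (hne : Y.Nonempty) (hcl : IsClosed Y)
    (z : Euc n) : projSet Y z ∈ Y ∧ ∀ q ∈ Y, ‖z - projSet Y z‖ ≤ ‖z - q‖ := by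
  refine Classical.epsilon_spec (p := fun p => p ∈ Y ∧ ∀ q ∈ Y, ‖z - p‖ ≤ ‖z - q‖) ?_
  obtain ⟨p, hp, h⟩ := hcl.exists_infDist_eq_dist hne z
  refine ⟨p, hp, fun q hq => ?_⟩
  rw [← dist_eq_norm, ← dist_eq_norm, ← h]
  exact Metric.infDist_le_dist_of_mem hq

theorem projSet_eq_iff {n : ℕ} {Y : Set (Euc n)} (hne : Y.Nonempty) (hcl : IsClosed Y)
    (hcv : Convex ℝ Y) (z p : Euc n) :
    projSet Y z = p ↔ p ∈ Y ∧ ∀ q ∈ Y, ‖z - p‖ ≤ ‖z - q‖ := by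
  constructor
  · rintro rfl
    exact projSet_spec hne hcl z
  · rintro ⟨hp, h⟩
    obtain ⟨hp', h'⟩ := projSet_spec hne hcl z
    have key : ∀ v ∈ Y, (∀ q ∈ Y, ‖z - v‖ ≤ ‖z - q‖) → ∀ w ∈ Y, inner ℝ (z - v) (w - v) ≤ 0 := by
      intro v hv hmin
      refine (norm_eq_iInf_iff_real_inner_le_zero hcv hv).1 ?_
      have : Nonempty Y := ⟨⟨v, hv⟩⟩
      refine le_antisymm (le_ciInf fun w => hmin w w.2) ?_
      exact ciInf_le ⟨0, Set.forall_mem_range.2 fun _ => norm_nonneg _⟩ (⟨v, hv⟩ : Y)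
    have h1 := key _ hp h _ hp'
    have h2 := key _ hp' h' _ hp
    have h3 : inner ℝ (projSet Y z - p) (projSet Y z - p) ≤ (0 : ℝ) := by
      have e : inner ℝ (projSet Y z - p) (projSet Y z - p)
          = (inner ℝ (z - p) (projSet Y z - p) : ℝ)
            + inner ℝ (z - projSet Y z) (p - projSet Y z) := by
        rw [show p - projSet Y z = -(projSet Y z - p) by abel, inner_neg_right,
          ← sub_eq_add_neg, ← inner_sub_left]
        congr 1
        abel
      rw [e]
      linarith
    exact sub_eq_zero.1 (real_inner_self_nonpos.1 h3)

/-- `y⁺ = P_Y (y + (1/ℓ) ∇_y f (x, y))`. -/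
noncomputable def ascentStep {m n : ℕ} (ℓ : ℝ) (Y : Set (Euc n)) (f : Euc m → Euc n → ℝ)
    (x : Euc m) (y : Euc n) : Euc n :=
  projSet Y (y + (1 / ℓ) • gradY f x y)

/-- `(x, y) ∈ ℝᵐ × Y` is an `ε`-stationary point of `f`. -/
def IsStationaryPair {m n : ℕ} (ℓ : ℝ) (Y : Set (Euc n)) (f : Euc m → Euc n → ℝ) (ε : ℝ)
    (x : Euc m) (y : Euc n) : Prop :=
  y ∈ Y ∧ ‖gradX f x (ascentStep ℓ Y f x y)‖ ≤ ε ∧ ‖ascentStep ℓ Y f x y - y‖ ≤ ε / ℓ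

/-- A random pair `(x, y)` with values in `ℝᵐ × Y` is an `ε`-stationary point of `f` in
expectation (in mean square). -/
def IsStationaryPairInExpectation {m n : ℕ} {Ω : Type*} [MeasurableSpace Ω] (μ : Measure Ω)
    (ℓ : ℝ) (Y : Set (Euc n)) (f : Euc m → Euc n → ℝ) (ε : ℝ)
    (x : Ω → Euc m) (y : Ω → Euc n) : Prop :=
  (∀ ω, y ω ∈ Y) ∧
  (Integrable (fun ω => ‖gradX f (x ω) (ascentStep ℓ Y f (x ω) (y ω))‖ ^ 2) μ ∧
    ∫ ω, ‖gradX f (x ω) (ascentStep ℓ Y f (x ω) (y ω))‖ ^ 2 ∂μ ≤ ε ^ 2) ∧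
  (Integrable (fun ω => ‖ascentStep ℓ Y f (x ω) (y ω) - y ω‖ ^ 2) μ ∧
    ∫ ω, ‖ascentStep ℓ Y f (x ω) (y ω) - y ω‖ ^ 2 ∂μ ≤ (ε / ℓ) ^ 2)

/-- `Φ(x) = max_{y ∈ Y} f (x, y)`. -/
noncomputable def maxFun {m n : ℕ} (Y : Set (Euc n)) (f : Euc m → Euc n → ℝ) (x : Euc m) : ℝ :=
  ⨆ y : Y, f x y

/-- The Moreau envelope `Φ_lam(x) = min_w Φ(w) + (1 / (2 lam)) ‖w - x‖²`. -/
noncomputable def moreauEnvelope {m : ℕ} (lam : ℝ) (Φ : Euc m → ℝ) (x : Euc m) : ℝ :=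
  ⨅ w : Euc m, (Φ w + 1 / (2 * lam) * ‖w - x‖ ^ 2)

/-- `x` is an `ε`-stationary point of the `ρ`-weakly convex function `Φ`:
`‖∇ Φ_{1/(2ρ)} (x)‖ ≤ ε`. -/
def IsMoreauStationary {m : ℕ} (ρ : ℝ) (Φ : Euc m → ℝ) (ε : ℝ) (x : Euc m) : Prop :=
  DifferentiableAt ℝ (moreauEnvelope (1 / (2 * ρ)) Φ) x ∧
    ‖gradient (moreauEnvelope (1 / (2 * ρ)) Φ) x‖ ≤ ε

/-- A (deterministic, adaptive) oracle method on the space `V` that makes `N` oracle calls: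
the `k`-th query is computed from the `k` answers received so far, and the output from all `N`
answers. The method has no other access to the problem instance behind the oracle. -/
structure OracleMethod (V : Type*) (N : ℕ) where
  query : (k : ℕ) → (Fin k → V) → V
  output : (Fin N → V) → V

namespace OracleMethod

/-- The first `k` answers received when the `j`-th query `v` is answered by `oracle j v`. -/
def answers {V : Type*} {N : ℕ} (A : OracleMethod V N) (oracle : ℕ → V → V) :
    (k : ℕ) → Fin k → V
  | 0 => Fin.elim0
  | k + 1 => Fin.snoc (α := fun _ => V) (A.answers oracle k)
      (oracle k (A.query k (A.answers oracle k)))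

/-- The output of the method after its `N` oracle calls. -/
def result {V : Type*} {N : ℕ} (A : OracleMethod V N) (oracle : ℕ → V → V) : V :=
  A.output (A.answers oracle N)

/-- All the maps that define the method are measurable. -/
def IsMeasurable {V : Type*} [MeasurableSpace V] {N : ℕ} (A : OracleMethod V N) : Prop :=
  (∀ k, Measurable (A.query k)) ∧ Measurable A.output

end OracleMethod

/-- `G(x, y, ξ)` with `ξ ∼ P` is a stochastic gradient of `f`: unbiased, with variance at most
`σ²` for the Euclidean norm on `ℝᵐ × ℝⁿ`. -/
structure IsStochasticGradient {m n : ℕ} {Ξ : Type*} [MeasurableSpace Ξ] (P : Measure Ξ) (σ : ℝ)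
    (f : Euc m → Euc n → ℝ) (G : Euc m × Euc n → Ξ → Euc m × Euc n) : Prop where
  measurable : Measurable (fun p : (Euc m × Euc n) × Ξ => G p.1 p.2)
  integrable : ∀ z, Integrable (G z) P
  unbiased : ∀ z, ∫ s, G z s ∂P = gradPair f z
  sq_integrable : ∀ z, Integrable
    (fun s => ‖(G z s).1 - gradX f z.1 z.2‖ ^ 2 + ‖(G z s).2 - gradY f z.1 z.2‖ ^ 2) P
  variance_le : ∀ z,
    ∫ s, (‖(G z s).1 - gradX f z.1 z.2‖ ^ 2 + ‖(G z s).2 - gradY f z.1 z.2‖ ^ 2) ∂P ≤ σ ^ 2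

/-! Fix `a` (the given point of `Φ`) and add `ℓ‖x - a‖²` to `f`. Since `f(·, y)` is `ℓ`-weakly
convex, the sum is `ℓ`-strongly convex in `x` and still concave in `y`, and it has a saddle point
`(x, y)` (`exists_isProxSaddle`). Its first component minimizes `Φ + ℓ‖· - a‖²`, and the envelope
has gradient `2ℓ(a - x)` at `a`. Hence `a` is `ε`-stationary for `Φ` exactly when `2ℓ‖x - a‖ ≤ ε`
(`isMoreauStationary_iff`), and both directions are statements about this distance.

From `f` to `Φ`: a short ascent step `p` from `(a, b)` nearly maximizes `f(a, ·)`, and a small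
`∇ₓf(a, p)` keeps `f(x, p)` from lying far below `f(a, p)`. Quadratic growth of `Φ + ℓ‖· - a‖²` at
`x` then bounds `‖x - a‖`.

From `Φ` to `f`: at the saddle point `∇ₓf = -2ℓ(x - a)` has norm at most `ε`, so a good
approximation of the saddle point suffices. If `ℓD < ε`, the pair `(a, y₀)` already works for any
`y₀` in `Y`. Otherwise the extragradient method is run from `(a, y₀)`, at squared distance at most
`2D²` from the saddle point, and its midpoints are averaged. The summed descent inequality bounds
the mean of `‖x_k - x‖²` and the mean gap `f(x, y) - f(x, y_k)` by multiples of `D²/(ηT)`.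

A small gap makes the ascent step short. The gradient in `x` needs more (`average_bounds`): the mean
regularized gradient along the midpoints telescopes to `(z_0 - z_T)/(ηT)`, and concavity of `f(x +
d, ·)` for a suitable `d` shows that averaging the `y_k` changes the gradient at `x` by at most the
square root of `4ℓ` times the mean gap. All squared errors are thus of order `ℓD²/(ηT)`, and a
constant `ηℓ` needs only `T` of order `ℓ²D²/ε²`.

With stochastic gradients each noise term is centred given the past, so cross terms vanish in
expectation, and what remains is of order `η²Tσ²` in the descent and `σ²/T` in the mean gradient.
The step size is divided by `1 + σ²/ε²`, and `T` is multiplied by it. Exact gradients are the case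
`σ = 0` on a one-point sample space. -/

/-! ### First-order inequalities for smooth and for concave functions. -/

section SmoothFunctions

variable {V : Type*} [NormedAddCommGroup V] [InnerProductSpace ℝ V] [CompleteSpace V]

/-- The derivative of `g` along a segment. -/
theorem HasGradientAt.hasDerivAt_segment {g : V → ℝ} {g' x v : V} {t : ℝ}
    (h : HasGradientAt g g' (x + t • v)) :
    HasDerivAt (fun s : ℝ => g (x + s • v)) (inner ℝ g' v) t := by
  have h1 : HasDerivAt (fun s : ℝ => x + s • v) v t := by
    simpa using ((hasDerivAt_id t).smul_const v).const_add x
  have h2 := h.hasFDerivAt.comp_hasDerivAt t h1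
  simpa [Function.comp_def] using h2

/-- The lower quadratic bound for a function with `ℓ`-Lipschitz gradient. -/
theorem lower_quadratic_of_lipschitz_gradient {ℓ : ℝ} {g : V → ℝ} {g' : V → V}
    (hg : ∀ x, HasGradientAt g (g' x) x) (hl : ∀ x x', ‖g' x - g' x'‖ ≤ ℓ * ‖x - x'‖)
    (x x' : V) : g x + inner ℝ (g' x) (x' - x) - ℓ / 2 * ‖x' - x‖ ^ 2 ≤ g x' := by
  set v := x' - x with hv
  -- The function minus its tangent plus the quadratic is nondecreasing on `[0, 1]`: the Lipschitz
  -- bound makes the first part of the derivative at least `-ℓt‖v‖²`, which the quadratic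
  -- compensates.
  have hd : ∀ t : ℝ, HasDerivAt
      (fun s : ℝ => g (x + s • v) - s * inner ℝ (g' x) v + ℓ / 2 * ‖v‖ ^ 2 * s ^ 2)
      (inner ℝ (g' (x + t • v)) v - inner ℝ (g' x) v + ℓ / 2 * ‖v‖ ^ 2 * (2 * t)) t := by
    intro t
    have h1 := (hg (x + t • v)).hasDerivAt_segment
    have h2 := (hasDerivAt_id t).mul_const (inner ℝ (g' x) v)
    have h3 := ((hasDerivAt_id t).pow 2).const_mul (ℓ / 2 * ‖v‖ ^ 2)
    have h4 := (h1.sub h2).add h3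
    refine h4.congr_deriv ?_
    simp
  have hm := monotoneOn_of_deriv_nonneg (convex_Icc (0 : ℝ) 1)
    (fun t _ => (hd t).continuousAt.continuousWithinAt)
    (fun t _ => (hd t).differentiableAt.differentiableWithinAt) (fun t ht => by
      rw [(hd t).deriv]
      rw [interior_Icc] at ht
      have h1 := hl (x + t • v) x
      have h2 : |inner ℝ (g' (x + t • v) - g' x) v| ≤ ‖g' (x + t • v) - g' x‖ * ‖v‖ :=
        abs_real_inner_le_norm _ _
      rw [inner_sub_left] at h2
      have h3 : ‖x + t • v - x‖ = t * ‖v‖ := by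
        rw [add_sub_cancel_left, norm_smul, Real.norm_of_nonneg ht.1.le]
      rw [h3] at h1
      have h4 := mul_le_mul_of_nonneg_right h1 (norm_nonneg v)
      have h5 := (abs_le.1 h2).1
      nlinarith)
  have := hm (Set.left_mem_Icc.2 zero_le_one) (Set.right_mem_Icc.2 zero_le_one) zero_le_one
  simp [hv] at this
  linarith

/-- The upper quadratic bound for a function with `ℓ`-Lipschitz gradient. -/
theorem upper_quadratic_of_lipschitz_gradient {ℓ : ℝ} {g : V → ℝ} {g' : V → V}
    (hg : ∀ x, HasGradientAt g (g' x) x) (hl : ∀ x x', ‖g' x - g' x'‖ ≤ ℓ * ‖x - x'‖)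
    (x x' : V) : g x' ≤ g x + inner ℝ (g' x) (x' - x) + ℓ / 2 * ‖x' - x‖ ^ 2 := by
  have h := lower_quadratic_of_lipschitz_gradient (g := fun z => -g z) (g' := fun z => -g' z)
    (ℓ := ℓ) (fun x => by
      have := (hg x).hasFDerivAt.neg
      rw [hasGradientAt_iff_hasFDerivAt, map_neg]
      exact this) (fun x x' => by
      rw [← neg_sub', norm_neg]; exact hl x x') x x'
  simp only [inner_neg_left] at h
  linarith

/-- The first-order inequality for concave functions on a convex set. -/
theorem ConcaveOn.le_add_inner_of_hasGradientAt {s : Set V} {g : V → ℝ} {g' x x' : V}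
    (hc : ConcaveOn ℝ s g) (hg : HasGradientAt g g' x) (hx : x ∈ s) (hx' : x' ∈ s) :
    g x' ≤ g x + inner ℝ g' (x' - x) := by
  have h1 : HasDerivAt (fun t : ℝ => g (x + t • (x' - x))) (inner ℝ g' (x' - x)) 0 :=
    HasGradientAt.hasDerivAt_segment (by simpa using hg)
  have h2 := h1.tendsto_slope_zero_right
  have h3 : g x' - g x ≤ inner ℝ g' (x' - x) := by
    refine ge_of_tendsto h2 ?_
    filter_upwards [Ioo_mem_nhdsGT (zero_lt_one' ℝ)] with t ht
    have h4 := hc.2 hx hx' (sub_nonneg.2 ht.2.le) ht.1.le (sub_add_cancel 1 t)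
    have h5 : (1 - t) • x + t • x' = x + t • (x' - x) := by
      rw [sub_smul, smul_sub, one_smul]; abel
    rw [h5] at h4
    simp only [smul_eq_mul, zero_add, zero_smul, add_zero] at h4 ⊢
    rw [inv_mul_eq_div, le_div_iff₀ ht.1]
    linarith
  linarith

end SmoothFunctions

/-! ### Partial gradients of a jointly smooth function. -/

namespace IsSmoothConcave

variable {m n : ℕ} {ℓ : ℝ} {Y : Set (Euc n)} {f : Euc m → Euc n → ℝ}

/-- Chain rule along the two inclusions; for the Euclidean norm on the product the Riesz
representative splits into components. This carries the joint hypothesis over to `gradX` and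
`gradY`. -/
theorem hasGradientAt_fst_snd (h : IsSmoothConcave ℓ Y f) (x : Euc m) (y : Euc n) :
    HasGradientAt (fun x' => f x' y)
      (gradient (fun z : WithLp 2 (Euc m × Euc n) => f z.fst z.snd) (WithLp.toLp 2 (x, y))).fst x ∧
    HasGradientAt (f x)
      (gradient (fun z : WithLp 2 (Euc m × Euc n) => f z.fst z.snd) (WithLp.toLp 2 (x, y))).snd y
    := by
  have hz := (h.smooth.1 (WithLp.toLp 2 (x, y))).hasGradientAt
  set p := gradient (fun z : WithLp 2 (Euc m × Euc n) => f z.fst z.snd) (WithLp.toLp 2 (x, y))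
  have he := (WithLp.prodContinuousLinearEquiv 2 ℝ (Euc m) (Euc n)).symm.hasFDerivAt (x := (x, y))
  constructor
  · have h1 := hz.hasFDerivAt.comp x
      (HasFDerivAt.comp (f := fun e => (e, y)) x he (hasFDerivAt_prodMk_left x y))
    rw [hasGradientAt_iff_hasFDerivAt]
    refine h1.congr_fderiv ?_
    ext v
    simp [WithLp.prod_inner_apply]
  · have h1 := hz.hasFDerivAt.comp y
      (HasFDerivAt.comp (f := fun e => (x, e)) y he (hasFDerivAt_prodMk_right x y))
    rw [hasGradientAt_iff_hasFDerivAt]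
    refine h1.congr_fderiv ?_
    ext v
    simp [WithLp.prod_inner_apply]

theorem hasGradientAt_left (h : IsSmoothConcave ℓ Y f) (x : Euc m) (y : Euc n) :
    HasGradientAt (fun x' => f x' y) (gradX f x y) x := by
  have := (h.hasGradientAt_fst_snd x y).1
  rwa [gradX, this.gradient]

theorem hasGradientAt_right (h : IsSmoothConcave ℓ Y f) (x : Euc m) (y : Euc n) :
    HasGradientAt (f x) (gradY f x y) y := by
  have := (h.hasGradientAt_fst_snd x y).2
  rwa [gradY, this.gradient]

/-- The joint Lipschitz bound for the two partial gradients. -/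
theorem sq_norm_grad_sub_le (h : IsSmoothConcave ℓ Y f)
    (x x' : Euc m) (y y' : Euc n) :
    ‖gradX f x y - gradX f x' y'‖ ^ 2 + ‖gradY f x y - gradY f x' y'‖ ^ 2
      ≤ ℓ ^ 2 * (‖x - x'‖ ^ 2 + ‖y - y'‖ ^ 2) := by
  have h1 := h.smooth.2 (WithLp.toLp 2 (x, y)) (WithLp.toLp 2 (x', y'))
  have h2 := pow_le_pow_left₀ (norm_nonneg _) h1 2
  rw [mul_pow, WithLp.prod_norm_sq_eq_of_L2, WithLp.prod_norm_sq_eq_of_L2] at h2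
  have hX : ∀ x y, gradX f x y = (gradient (fun z : WithLp 2 (Euc m × Euc n) => f z.fst z.snd)
      (WithLp.toLp 2 (x, y))).fst := fun x y => (h.hasGradientAt_fst_snd x y).1.gradient
  have hY : ∀ x y, gradY f x y = (gradient (fun z : WithLp 2 (Euc m × Euc n) => f z.fst z.snd)
      (WithLp.toLp 2 (x, y))).snd := fun x y => (h.hasGradientAt_fst_snd x y).2.gradient
  rw [hX, hX, hY, hY]
  simpa using h2

theorem norm_gradX_sub_le (h : IsSmoothConcave ℓ Y f) (hℓ : 0 ≤ ℓ)
    (x x' : Euc m) (y y' : Euc n) :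
    ‖gradX f x y - gradX f x' y'‖ ≤ ℓ * (‖x - x'‖ + ‖y - y'‖) := by
  refine abs_le_of_sq_le_sq' ?_ (by positivity) |>.2
  have := h.sq_norm_grad_sub_le x x' y y'
  nlinarith [sq_nonneg ‖gradY f x y - gradY f x' y'‖, mul_nonneg (sq_nonneg ℓ)
    (mul_nonneg (norm_nonneg (x - x')) (norm_nonneg (y - y')))]

theorem norm_gradX_sub_le_left (h : IsSmoothConcave ℓ Y f) (hℓ : 0 ≤ ℓ)
    (x x' : Euc m) (y : Euc n) : ‖gradX f x y - gradX f x' y‖ ≤ ℓ * ‖x - x'‖ := by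
  simpa using h.norm_gradX_sub_le hℓ x x' y y

theorem norm_gradX_sub_le_right (h : IsSmoothConcave ℓ Y f) (hℓ : 0 ≤ ℓ)
    (x : Euc m) (y y' : Euc n) : ‖gradX f x y - gradX f x y'‖ ≤ ℓ * ‖y - y'‖ := by
  simpa using h.norm_gradX_sub_le hℓ x x y y'

theorem norm_gradY_sub_le (h : IsSmoothConcave ℓ Y f) (hℓ : 0 ≤ ℓ)
    (x x' : Euc m) (y y' : Euc n) :
    ‖gradY f x y - gradY f x' y'‖ ≤ ℓ * (‖x - x'‖ + ‖y - y'‖) := by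
  refine abs_le_of_sq_le_sq' ?_ (by positivity) |>.2
  have := h.sq_norm_grad_sub_le x x' y y'
  nlinarith [sq_nonneg ‖gradX f x y - gradX f x' y'‖, mul_nonneg (sq_nonneg ℓ)
    (mul_nonneg (norm_nonneg (x - x')) (norm_nonneg (y - y')))]

theorem norm_gradY_sub_le_left (h : IsSmoothConcave ℓ Y f) (hℓ : 0 ≤ ℓ)
    (x x' : Euc m) (y : Euc n) : ‖gradY f x y - gradY f x' y‖ ≤ ℓ * ‖x - x'‖ := by
  simpa using h.norm_gradY_sub_le hℓ x x' y y

theorem norm_gradY_sub_le_right (h : IsSmoothConcave ℓ Y f) (hℓ : 0 ≤ ℓ)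
    (x : Euc m) (y y' : Euc n) : ‖gradY f x y - gradY f x y'‖ ≤ ℓ * ‖y - y'‖ := by
  simpa using h.norm_gradY_sub_le hℓ x x y y'

theorem continuous_gradX (h : IsSmoothConcave ℓ Y f) (hℓ : 0 ≤ ℓ) :
    Continuous (fun z : Euc m × Euc n => gradX f z.1 z.2) := by
  refine continuous_iff_continuousAt.2 fun z => ?_
  refine tendsto_iff_norm_sub_tendsto_zero.2 ?_
  refine squeeze_zero (fun _ => norm_nonneg _) (fun w => h.norm_gradX_sub_le hℓ _ _ _ _) ?_
  have : Continuous fun w : Euc m × Euc n => ℓ * (‖w.1 - z.1‖ + ‖w.2 - z.2‖) := by fun_prop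
  simpa using this.tendsto z

theorem continuous_gradY (h : IsSmoothConcave ℓ Y f) (hℓ : 0 ≤ ℓ) :
    Continuous (fun z : Euc m × Euc n => gradY f z.1 z.2) := by
  refine continuous_iff_continuousAt.2 fun z => ?_
  refine tendsto_iff_norm_sub_tendsto_zero.2 ?_
  refine squeeze_zero (fun _ => norm_nonneg _) (fun w => h.norm_gradY_sub_le hℓ _ _ _ _) ?_
  have : Continuous fun w : Euc m × Euc n => ℓ * (‖w.1 - z.1‖ + ‖w.2 - z.2‖) := by fun_prop
  simpa using this.tendsto z

theorem continuous_right (h : IsSmoothConcave ℓ Y f) (x : Euc m) : Continuous (f x) :=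
  continuous_iff_continuousAt.2 fun y => (h.hasGradientAt_right x y).continuousAt

theorem continuous_left (h : IsSmoothConcave ℓ Y f) (y : Euc n) : Continuous fun x => f x y :=
  continuous_iff_continuousAt.2 fun x => (h.hasGradientAt_left x y).continuousAt

theorem lower_left (h : IsSmoothConcave ℓ Y f) (hℓ : 0 ≤ ℓ) (x x' : Euc m) (y : Euc n) :
    f x y + inner ℝ (gradX f x y) (x' - x) - ℓ / 2 * ‖x' - x‖ ^ 2 ≤ f x' y :=
  lower_quadratic_of_lipschitz_gradient (fun x => h.hasGradientAt_left x y)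
    (fun x x' => h.norm_gradX_sub_le_left hℓ x x' y) x x'

theorem upper_left (h : IsSmoothConcave ℓ Y f) (hℓ : 0 ≤ ℓ) (x x' : Euc m) (y : Euc n) :
    f x' y ≤ f x y + inner ℝ (gradX f x y) (x' - x) + ℓ / 2 * ‖x' - x‖ ^ 2 :=
  upper_quadratic_of_lipschitz_gradient (fun x => h.hasGradientAt_left x y)
    (fun x x' => h.norm_gradX_sub_le_left hℓ x x' y) x x'

theorem lower_right (h : IsSmoothConcave ℓ Y f) (hℓ : 0 ≤ ℓ) (x : Euc m) (y y' : Euc n) :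
    f x y + inner ℝ (gradY f x y) (y' - y) - ℓ / 2 * ‖y' - y‖ ^ 2 ≤ f x y' :=
  lower_quadratic_of_lipschitz_gradient (h.hasGradientAt_right x)
    (h.norm_gradY_sub_le_right hℓ x) y y'

theorem concave_right (h : IsSmoothConcave ℓ Y f) (x : Euc m) {y y' : Euc n} (hy : y ∈ Y)
    (hy' : y' ∈ Y) : f x y' ≤ f x y + inner ℝ (gradY f x y) (y' - y) :=
  (h.concave x).le_add_inner_of_hasGradientAt (h.hasGradientAt_right x y) hy hy'

/-- The strong convexity of `f (·, y) + ℓ ‖· - a‖²`. -/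
theorem regularized_lower_left (h : IsSmoothConcave ℓ Y f) (hℓ : 0 ≤ ℓ) (a x x' : Euc m)
    (y : Euc n) :
    f x y + ℓ * ‖x - a‖ ^ 2 + inner ℝ (gradX f x y + (2 * ℓ) • (x - a)) (x' - x)
      + ℓ / 2 * ‖x' - x‖ ^ 2 ≤ f x' y + ℓ * ‖x' - a‖ ^ 2 := by
  have h1 := h.lower_left hℓ x x' y
  have h2 : ‖x' - a‖ ^ 2 = ‖x - a‖ ^ 2 + 2 * inner ℝ (x - a) (x' - x) + ‖x' - x‖ ^ 2 := by
    rw [← norm_add_sq_real]; congr 2; abel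
  rw [inner_add_left, inner_smul_left, h2]
  simp only [conj_trivial]
  linarith

/-- The smoothness of `f (·, y) + ℓ ‖· - a‖²`. -/
theorem regularized_upper_left (h : IsSmoothConcave ℓ Y f) (hℓ : 0 ≤ ℓ) (a x x' : Euc m)
    (y : Euc n) :
    f x' y + ℓ * ‖x' - a‖ ^ 2 ≤
      f x y + ℓ * ‖x - a‖ ^ 2 + inner ℝ (gradX f x y + (2 * ℓ) • (x - a)) (x' - x)
      + 3 * ℓ / 2 * ‖x' - x‖ ^ 2 := by
  have h1 := h.upper_left hℓ x x' y
  have h2 : ‖x' - a‖ ^ 2 = ‖x - a‖ ^ 2 + 2 * inner ℝ (x - a) (x' - x) + ‖x' - x‖ ^ 2 := by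
    rw [← norm_add_sq_real]; congr 2; abel
  rw [inner_add_left, inner_smul_left, h2]
  simp only [conj_trivial]
  linarith

end IsSmoothConcave

/-! ### Projection onto the constraint set. -/

section Projection

variable {n : ℕ} {D : ℝ} {Y : Set (Euc n)}

theorem IsConstraintSet.projSet_mem (hY : IsConstraintSet D Y) (z : Euc n) : projSet Y z ∈ Y :=
  (projSet_spec hY.nonempty hY.closed z).1

/-- The variational inequality that characterizes the projection. -/
theorem IsConstraintSet.inner_projSet_le (hY : IsConstraintSet D Y) (z : Euc n) {q : Euc n}
    (hq : q ∈ Y) : inner ℝ (z - projSet Y z) (q - projSet Y z) ≤ 0 := by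
  obtain ⟨hp, hmin⟩ := projSet_spec hY.nonempty hY.closed z
  refine (norm_eq_iInf_iff_real_inner_le_zero hY.convex hp).1 ?_ q hq
  have : Nonempty Y := ⟨⟨_, hp⟩⟩
  refine le_antisymm (le_ciInf fun w => hmin w w.2) ?_
  exact ciInf_le ⟨0, Set.forall_mem_range.2 fun _ => norm_nonneg _⟩ (⟨_, hp⟩ : Y)

theorem IsConstraintSet.norm_projSet_sub_le (hY : IsConstraintSet D Y) (z z' : Euc n) :
    ‖projSet Y z - projSet Y z'‖ ≤ ‖z - z'‖ := by
  have h1 := hY.inner_projSet_le z (hY.projSet_mem z')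
  have h2 := hY.inner_projSet_le z' (hY.projSet_mem z)
  set p := projSet Y z
  set p' := projSet Y z'
  have h3 : ‖p - p'‖ ^ 2 ≤ inner ℝ (z - z') (p - p') := by
    rw [← real_inner_self_eq_norm_sq]
    have e : inner ℝ (p - p') (p - p') = inner ℝ (z - z') (p - p') + inner ℝ (z - p) (p' - p)
        + inner ℝ (z' - p') (p - p') := by
      rw [show p' - p = -(p - p') by abel, inner_neg_right, ← sub_eq_add_neg, ← inner_sub_left,
        ← inner_add_left]
      congr 1; abel
    linarith
  have h4 := real_inner_le_norm (z - z') (p - p')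
  by_contra! hlt
  nlinarith [norm_nonneg (z - z')]

theorem IsConstraintSet.continuous_projSet (hY : IsConstraintSet D Y) :
    Continuous (projSet Y) :=
  (LipschitzWith.of_dist_le_mul (K := 1) fun z z' => by
    simpa [dist_eq_norm] using hY.norm_projSet_sub_le z z').continuous

theorem IsConstraintSet.norm_sub_le (hY : IsConstraintSet D Y) {y y' : Euc n} (hy : y ∈ Y)
    (hy' : y' ∈ Y) : ‖y - y'‖ ≤ D := by
  rw [← dist_eq_norm, ← hY.diam_eq]
  exact Metric.dist_le_diam_of_mem hY.bounded hy hy'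

theorem IsConstraintSet.diam_nonneg (hY : IsConstraintSet D Y) : 0 ≤ D :=
  hY.diam_eq ▸ Metric.diam_nonneg

theorem IsConstraintSet.isCompact (hY : IsConstraintSet D Y) : IsCompact Y :=
  Metric.isCompact_of_isClosed_isBounded hY.closed hY.bounded

end Projection

/-! ### Saddle points of the regularized problem and the gradient of the Moreau envelope. -/

/-- `(x, y)` is a saddle point of `f (x, y) + ℓ ‖x - a‖²` on `ℝᵐ × Y`. -/
structure IsProxSaddle {m n : ℕ} (ℓ : ℝ) (Y : Set (Euc n)) (f : Euc m → Euc n → ℝ) (a : Euc m)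
    (x : Euc m) (y : Euc n) : Prop where
  mem : y ∈ Y
  gradX_eq : gradX f x y + (2 * ℓ) • (x - a) = 0
  le_max : ∀ y' ∈ Y, f x y' ≤ f x y

section Saddle

variable {m n : ℕ} {ℓ D : ℝ} {Y : Set (Euc n)} {f : Euc m → Euc n → ℝ}

namespace IsSmoothConcave

theorem continuous_uncurry (h : IsSmoothConcave ℓ Y f) :
    Continuous fun z : Euc m × Euc n => f z.1 z.2 :=
  continuous_iff_continuousAt.2 fun z =>
    ((h.smooth.1 (WithLp.toLp 2 z)).hasGradientAt.hasFDerivAt.comp z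
      (WithLp.prodContinuousLinearEquiv 2 ℝ (Euc m) (Euc n)).symm.hasFDerivAt).continuousAt

/-- Strong convexity makes the regularized function coercive, so a minimizer exists; one gradient
step from it cannot decrease the value, so the gradient vanishes there. -/
theorem exists_regularized_gradX_eq_zero (h : IsSmoothConcave ℓ Y f) (hℓ : 0 < ℓ) (a : Euc m)
    (y : Euc n) : ∃ x, gradX f x y + (2 * ℓ) • (x - a) = 0 := by
  set F : Euc m → ℝ := fun x => f x y + ℓ * ‖x - a‖ ^ 2 with hF
  have hcont : Continuous F := by
    have := h.continuous_left y
    fun_prop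
  set g := gradX f a y + (2 * ℓ) • (a - a) with hg
  -- Outside this radius the quadratic term `ℓ/2 ‖x' - a‖²` outweighs the linear term `‖g‖‖x' - a‖`,
  -- so the value exceeds that at the centre.
  set r := 2 * ‖g‖ / ℓ with hr
  have hr0 : 0 ≤ r := by positivity
  obtain ⟨x, -, hx⟩ := (isCompact_closedBall a r).exists_isMinOn
    ⟨a, Metric.mem_closedBall_self hr0⟩ hcont.continuousOn
  have hmin : ∀ x', F x ≤ F x' := by
    intro x'
    by_cases hx' : x' ∈ Metric.closedBall a r
    · exact hx hx'
    · refine (hx (Metric.mem_closedBall_self hr0)).trans ?_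
      rw [Metric.mem_closedBall, dist_eq_norm, not_le, hr, div_lt_iff₀ hℓ] at hx'
      have h1 := h.regularized_lower_left hℓ.le a a x' y
      have h2 := (abs_le.1 (abs_real_inner_le_norm g (x' - a))).1
      simp only [hF]
      rw [← hg] at h1
      nlinarith [norm_nonneg (x' - a)]
  refine ⟨x, ?_⟩
  set p := gradX f x y + (2 * ℓ) • (x - a)
  -- The regularized function is `3ℓ`-smooth from above; the step `1/(3ℓ)` would gain `‖p‖²/(6ℓ)`.
  have h1 := h.regularized_upper_left hℓ.le a x (x - (1 / (3 * ℓ)) • p) y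
  have h2 := hmin (x - (1 / (3 * ℓ)) • p)
  have h3 : x - (1 / (3 * ℓ)) • p - x = -((1 / (3 * ℓ)) • p) := by abel
  rw [h3, inner_neg_right, inner_smul_right, norm_neg, norm_smul, mul_pow,
    real_inner_self_eq_norm_sq, Real.norm_of_nonneg (by positivity)] at h1
  simp only [hF] at h2
  have h4 : 0 ≤ -(1 / (3 * ℓ) * ‖p‖ ^ 2) + 3 * ℓ / 2 * ((1 / (3 * ℓ)) ^ 2 * ‖p‖ ^ 2) := by
    linarith
  have h5 : -(1 / (3 * ℓ) * ‖p‖ ^ 2) + 3 * ℓ / 2 * ((1 / (3 * ℓ)) ^ 2 * ‖p‖ ^ 2)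
      = -(1 / (6 * ℓ)) * ‖p‖ ^ 2 := by field_simp; ring
  rw [h5] at h4
  have h6 : 0 < 1 / (6 * ℓ) := by positivity
  have h7 : ‖p‖ ^ 2 ≤ 0 := by nlinarith
  simpa using le_antisymm h7 (sq_nonneg _)

/-- The minimizers of `f (·, y) + ℓ ‖· - a‖²` depend on `y` in a nonexpansive way. -/
theorem norm_sub_le_of_regularized_gradX_eq_zero (h : IsSmoothConcave ℓ Y f) (hℓ : 0 < ℓ)
    {a x x' : Euc m} {y y' : Euc n} (hx : gradX f x y + (2 * ℓ) • (x - a) = 0)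
    (hx' : gradX f x' y' + (2 * ℓ) • (x' - a) = 0) : ‖x - x'‖ ≤ ‖y - y'‖ := by
  -- The two strong convexity inequalities add up to `ℓ‖x - x'‖² ≤ ℓ‖y - y'‖‖x - x'‖`: the modulus
  -- equals the Lipschitz constant of `∇ₓf` in `y`.
  have h1 := h.regularized_lower_left hℓ.le a x x' y
  have h2 := h.regularized_lower_left hℓ.le a x' x y
  have h3 : gradX f x' y + (2 * ℓ) • (x' - a) = gradX f x' y - gradX f x' y' := by
    rw [← sub_zero (gradX f x' y + _), ← hx']; abel
  have h4 := h.norm_gradX_sub_le_right hℓ.le x' y y'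
  have h5 := (abs_le.1 (abs_real_inner_le_norm (gradX f x' y - gradX f x' y') (x - x'))).1
  have h6 := mul_le_mul_of_nonneg_right h4 (norm_nonneg (x - x'))
  rw [hx, inner_zero_left, norm_sub_rev x' x] at h1
  rw [h3] at h2
  by_contra! hlt
  have h7 : 0 < ‖x - x'‖ := (norm_nonneg _).trans_lt hlt
  nlinarith [mul_pos (mul_pos hℓ (sub_pos.2 hlt)) h7]

/-- No minimax theorem is used. Let `X y` minimize the regularized function `F(·, y)`, and let `y`
maximize `F(X y, y)` over the compact `Y`. For `y_t` on the segment from `y` to `y'` and `x_t = X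
y_t`, maximality and concavity give `F(X y, y) ≥ F(x_t, y_t) ≥ (1 - t)F(x_t, y) + tF(x_t, y')`, and
`F(x_t, y) ≥ F(X y, y)`. Hence `F(x_t, y') ≤ F(X y, y)`, and `t → 0` concludes by continuity of `X`.
-/
theorem exists_isProxSaddle (h : IsSmoothConcave ℓ Y f) (hℓ : 0 < ℓ) (hY : IsConstraintSet D Y)
    (a : Euc m) : ∃ x y, IsProxSaddle ℓ Y f a x y := by
  choose X hX using h.exists_regularized_gradX_eq_zero hℓ a
  have hXc : Continuous X := (LipschitzWith.of_dist_le_mul (K := 1) fun y y' => by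
    simpa [dist_eq_norm] using
      h.norm_sub_le_of_regularized_gradX_eq_zero hℓ (hX y) (hX y')).continuous
  have hfc := h.continuous_uncurry
  have hXmin : ∀ y x, f (X y) y + ℓ * ‖X y - a‖ ^ 2 ≤ f x y + ℓ * ‖x - a‖ ^ 2 := by
    intro y x
    have h1 := h.regularized_lower_left hℓ.le a (X y) x y
    rw [hX, inner_zero_left] at h1
    nlinarith [sq_nonneg ‖x - X y‖]
  have hΨ : Continuous fun y => f (X y) y + ℓ * ‖X y - a‖ ^ 2 := by
    have h1 : Continuous fun y => f (X y) y := hfc.comp (hXc.prodMk continuous_id)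
    fun_prop
  obtain ⟨y, hy, hmax⟩ := hY.isCompact.exists_isMaxOn hY.nonempty hΨ.continuousOn
  refine ⟨X y, y, hy, hX y, fun y' hy' => ?_⟩
  have hseg : Continuous fun t : ℝ => f (X (y + t • (y' - y))) y'
      + ℓ * ‖X (y + t • (y' - y)) - a‖ ^ 2 := by
    have h0 : Continuous fun t : ℝ => X (y + t • (y' - y)) := hXc.comp (by fun_prop)
    have h1 : Continuous fun t : ℝ => f (X (y + t • (y' - y))) y' :=
      hfc.comp (h0.prodMk continuous_const)
    fun_prop
  have hlim := (hseg.tendsto 0).mono_left (nhdsWithin_le_nhds (s := Set.Ioi 0))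
  have key : f (X y) y' + ℓ * ‖X y - a‖ ^ 2 ≤ f (X y) y + ℓ * ‖X y - a‖ ^ 2 := by
    simp only [zero_smul, add_zero] at hlim
    refine le_of_tendsto hlim ?_
    filter_upwards [Ioo_mem_nhdsGT (zero_lt_one' ℝ)] with t ht
    set x := X (y + t • (y' - y))
    have e : (1 - t) • y + t • y' = y + t • (y' - y) := by
      rw [sub_smul, smul_sub, one_smul]; abel
    have h1 := (h.concave x).2 hy hy' (sub_nonneg.2 ht.2.le) ht.1.le (sub_add_cancel 1 t)
    have h2 : y + t • (y' - y) ∈ Y := by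
      rw [← e]
      exact hY.convex hy hy' (sub_nonneg.2 ht.2.le) ht.1.le (sub_add_cancel 1 t)
    have h3 : f x (y + t • (y' - y)) + ℓ * ‖x - a‖ ^ 2 ≤ f (X y) y + ℓ * ‖X y - a‖ ^ 2 := hmax h2
    have h4 := mul_le_mul_of_nonneg_left (hXmin y x) (sub_nonneg.2 ht.2.le)
    rw [e] at h1
    simp only [smul_eq_mul] at h1
    refine le_of_mul_le_mul_left ?_ ht.1
    linarith
  linarith

theorem bddAbove_range (h : IsSmoothConcave ℓ Y f) (hY : IsConstraintSet D Y) (x : Euc m) :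
    BddAbove (Set.range fun y : Y => f x y) := by
  have := hY.isCompact.bddAbove_image (h.continuous_right x).continuousOn
  rwa [Set.image_eq_range] at this

theorem le_maxFun (h : IsSmoothConcave ℓ Y f) (hY : IsConstraintSet D Y) (x : Euc m) {y : Euc n}
    (hy : y ∈ Y) : f x y ≤ maxFun Y f x :=
  le_ciSup (h.bddAbove_range hY x) ⟨y, hy⟩

end IsSmoothConcave

theorem maxFun_le {x : Euc m} {c : ℝ} (hne : Y.Nonempty) (hc : ∀ y ∈ Y, f x y ≤ c) :
    maxFun Y f x ≤ c :=
  have := hne.to_subtype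
  ciSup_le fun y => hc y y.2

namespace IsProxSaddle

variable {a x : Euc m} {y : Euc n}

theorem maxFun_eq (hs : IsProxSaddle ℓ Y f a x y) (h : IsSmoothConcave ℓ Y f)
    (hY : IsConstraintSet D Y) : maxFun Y f x = f x y :=
  le_antisymm (maxFun_le hY.nonempty hs.le_max) (h.le_maxFun hY x hs.mem)

/-- Quadratic growth of `Φ + ℓ ‖· - a‖²` at its minimizer. -/
theorem add_sq_le (hs : IsProxSaddle ℓ Y f a x y) (h : IsSmoothConcave ℓ Y f)
    (hℓ : 0 < ℓ) (hY : IsConstraintSet D Y) (w : Euc m) :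
    maxFun Y f x + ℓ * ‖x - a‖ ^ 2 + ℓ / 2 * ‖w - x‖ ^ 2 ≤ maxFun Y f w + ℓ * ‖w - a‖ ^ 2 := by
  have h1 := h.regularized_lower_left hℓ.le a x w y
  have h2 := h.le_maxFun hY w hs.mem
  rw [hs.gradX_eq, inner_zero_left] at h1
  rw [hs.maxFun_eq h hY]
  linarith

theorem envelope_coeff (hℓ : 0 < ℓ) : 1 / (2 * (1 / (2 * ℓ))) = ℓ := by
  field_simp

theorem hasGradientAt_moreauEnvelope (hs : IsProxSaddle ℓ Y f a x y) (h : IsSmoothConcave ℓ Y f)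
    (hℓ : 0 < ℓ) (hY : IsConstraintSet D Y) :
    HasGradientAt (moreauEnvelope (1 / (2 * ℓ)) (maxFun Y f)) ((2 * ℓ) • (a - x)) a := by
  set c := maxFun Y f x + ℓ * ‖x - a‖ ^ 2 with hc
  -- The envelope is caught between two paraboloids that are tangent at `a`. For the lower one, the
  -- growth term `ℓ/2 ‖w - x‖²` absorbs the cross term `2ℓ⟨w - x, b - a⟩` at the cost of `2ℓ‖b -
  -- a‖²`; the upper one comes from the competitor `x`.
  have hlow : ∀ b w, c + 2 * ℓ * inner ℝ (a - x) (b - a) - ℓ * ‖b - a‖ ^ 2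
      ≤ maxFun Y f w + ℓ * ‖w - b‖ ^ 2 := by
    intro b w
    have h1 := hs.add_sq_le h hℓ hY w
    have h2 : ‖w - b‖ ^ 2 = ‖w - a‖ ^ 2 - 2 * inner ℝ (w - a) (b - a) + ‖b - a‖ ^ 2 := by
      rw [← norm_sub_sq_real]; congr 2; abel
    have h3 : inner ℝ (w - a) (b - a) = inner ℝ (w - x) (b - a) - inner ℝ (a - x) (b - a) := by
      rw [← inner_sub_left]; congr 1; abel
    have h4 := (abs_le.1 (abs_real_inner_le_norm (w - x) (b - a))).2
    rw [h2, h3]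
    nlinarith [sq_nonneg (‖w - x‖ - 2 * ‖b - a‖)]
  have hup : ∀ b, moreauEnvelope (1 / (2 * ℓ)) (maxFun Y f) b
      ≤ c + 2 * ℓ * inner ℝ (a - x) (b - a) + ℓ * ‖b - a‖ ^ 2 := by
    intro b
    have h1 : moreauEnvelope (1 / (2 * ℓ)) (maxFun Y f) b ≤ maxFun Y f x + ℓ * ‖x - b‖ ^ 2 := by
      simp only [moreauEnvelope, envelope_coeff hℓ]
      exact ciInf_le ⟨_, Set.forall_mem_range.2 (hlow b)⟩ x
    have h2 : ‖x - b‖ ^ 2 = ‖x - a‖ ^ 2 + 2 * inner ℝ (a - x) (b - a) + ‖b - a‖ ^ 2 := by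
      rw [norm_sub_rev x a, ← norm_add_sq_real, norm_sub_rev]; congr 2; abel
    rw [h2] at h1
    linarith
  have hlo : ∀ b, c + 2 * ℓ * inner ℝ (a - x) (b - a) - ℓ * ‖b - a‖ ^ 2
      ≤ moreauEnvelope (1 / (2 * ℓ)) (maxFun Y f) b := by
    intro b
    simp only [moreauEnvelope, envelope_coeff hℓ]
    exact le_ciInf (hlow b)
  have hval : moreauEnvelope (1 / (2 * ℓ)) (maxFun Y f) a = c := by
    refine le_antisymm ?_ ?_
    · simpa using hup a
    · simpa using hlo a
  rw [hasGradientAt_iff_isLittleO]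
  have hO : (fun b => moreauEnvelope (1 / (2 * ℓ)) (maxFun Y f) b
      - moreauEnvelope (1 / (2 * ℓ)) (maxFun Y f) a - inner ℝ ((2 * ℓ) • (a - x)) (b - a))
      =O[nhds a] fun b => ‖b - a‖ ^ 2 := by
    refine Asymptotics.IsBigO.of_bound ℓ (Filter.Eventually.of_forall fun b => ?_)
    rw [hval, inner_smul_left, Real.norm_eq_abs, Real.norm_of_nonneg (sq_nonneg _), abs_le]
    have h1 := hup b
    have h2 := hlo b
    simp only [conj_trivial]
    constructor <;> linarith
  refine hO.trans_isLittleO ?_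
  have h1 : (fun b : Euc m => ‖b - a‖ ^ 2) =o[nhds a] fun b => ‖b - a‖ := by
    have h2 := Asymptotics.isLittleO_pow_pow (𝕜 := ℝ) (m := 1) (n := 2) one_lt_two
    simp only [pow_one] at h2
    refine h2.comp_tendsto ?_
    have : Continuous fun b : Euc m => ‖b - a‖ := by fun_prop
    simpa using this.tendsto a
  exact h1.of_norm_right

/-- Differentiability of the envelope is automatic here, so stationarity is only a bound on the
distance from `a` to its proximal point. -/
theorem isMoreauStationary_iff (hs : IsProxSaddle ℓ Y f a x y) (h : IsSmoothConcave ℓ Y f)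
    (hℓ : 0 < ℓ) (hY : IsConstraintSet D Y) {ε : ℝ} :
    IsMoreauStationary ℓ (maxFun Y f) ε a ↔ 2 * ℓ * ‖x - a‖ ≤ ε := by
  have hg := hs.hasGradientAt_moreauEnvelope h hℓ hY
  rw [IsMoreauStationary, hg.gradient, norm_smul, Real.norm_of_nonneg (by positivity),
    norm_sub_rev]
  exact and_iff_right hg.differentiableAt

end IsProxSaddle

/-! ### From stationary pairs of `f` to stationary points of `Φ`. -/

/-- The ascent step almost maximizes `f (x, ·)` on `Y` if it is short. -/
theorem IsSmoothConcave.le_ascentStep_add (h : IsSmoothConcave ℓ Y f) (hℓ : 0 < ℓ)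
    (hY : IsConstraintSet D Y) (x : Euc m) {y y' : Euc n} (hy : y ∈ Y) (hy' : y' ∈ Y) :
    f x y' + ℓ / 2 * ‖ascentStep ℓ Y f x y - y‖ ^ 2 ≤
      f x (ascentStep ℓ Y f x y) + ℓ * inner ℝ (ascentStep ℓ Y f x y - y) (y' - y) := by
  -- Scaled by `ℓ`, the projection inequality cancels the gradient terms of the concave upper bound
  -- at `y'` and of the quadratic lower bound at `p`.
  have h1 := hY.inner_projSet_le (y + (1 / ℓ) • gradY f x y) hy'
  change inner ℝ (y + (1 / ℓ) • gradY f x y - ascentStep ℓ Y f x y)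
    (y' - ascentStep ℓ Y f x y) ≤ 0 at h1
  set p := ascentStep ℓ Y f x y
  have h2 := h.concave_right x hy hy'
  have h3 := h.lower_right hℓ.le x y p
  have e1 : y + (1 / ℓ) • gradY f x y - p = (1 / ℓ) • gradY f x y - (p - y) := by abel
  have e2 : y' - p = (y' - y) - (p - y) := by abel
  rw [e1, e2, inner_sub_left, inner_smul_left, inner_sub_right, inner_sub_right (p - y),
    real_inner_self_eq_norm_sq] at h1
  simp only [conj_trivial] at h1
  have h4 := mul_le_mul_of_nonneg_left h1 hℓ.le
  have e3 : ℓ * (1 / ℓ * (inner ℝ (gradY f x y) (y' - y) - inner ℝ (gradY f x y) (p - y))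
      - (inner ℝ (p - y) (y' - y) - ‖p - y‖ ^ 2)) =
      inner ℝ (gradY f x y) (y' - y) - inner ℝ (gradY f x y) (p - y)
      - ℓ * (inner ℝ (p - y) (y' - y) - ‖p - y‖ ^ 2) := by
    field_simp
  rw [e3] at h4
  linarith

theorem isMoreauStationary_of_isStationaryPair (h : IsSmoothConcave ℓ Y f) (hℓ : 0 < ℓ)
    (hY : IsConstraintSet D Y) {ε : ℝ} (hε : 0 ≤ ε) {a : Euc m} {b : Euc n}
    (hs : IsStationaryPair ℓ Y f (ε ^ 2 / max 1 (ℓ * D)) a b) :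
    IsMoreauStationary ℓ (maxFun Y f) (4 * ε ^ 2 + 4 * ε) a := by
  obtain ⟨hb, hgx, hst⟩ := hs
  obtain ⟨x, y, hxy⟩ := h.exists_isProxSaddle hℓ hY a
  rw [hxy.isMoreauStationary_iff h hℓ hY]
  have hp : ascentStep ℓ Y f a b ∈ Y := hY.projSet_mem _
  have hasc := fun y' (hy' : y' ∈ Y) => h.le_ascentStep_add hℓ hY a hb hy'
  set p := ascentStep ℓ Y f a b
  set δ := ε ^ 2 / max 1 (ℓ * D) with hδ
  have hM1 : 1 ≤ max 1 (ℓ * D) := le_max_left _ _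
  have hδ0 : 0 ≤ δ := by positivity
  have hδM : δ * max 1 (ℓ * D) = ε ^ 2 := div_mul_cancel₀ _ (by positivity)
  have hδ1 : δ ≤ ε ^ 2 := by nlinarith
  have hδ2 : δ * (ℓ * D) ≤ ε ^ 2 := by
    rw [← hδM]; exact mul_le_mul_of_nonneg_left (le_max_right _ _) hδ0
  have hΦ : maxFun Y f a ≤ f a p + δ * D := by
    refine maxFun_le hY.nonempty fun y' hy' => ?_
    have h1 := hasc y' hy'
    have h2 := (abs_le.1 (abs_real_inner_le_norm (p - b) (y' - b))).2
    have h3 := hY.norm_sub_le hy' hb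
    have h4 : ‖p - b‖ * ‖y' - b‖ ≤ δ / ℓ * D :=
      mul_le_mul hst h3 (norm_nonneg _) (by positivity)
    have h5 : ℓ * (δ / ℓ * D) = δ * D := by field_simp
    nlinarith [sq_nonneg ‖p - b‖]
  have h1 := hxy.add_sq_le h hℓ hY a
  have h2 := h.le_maxFun hY x hp
  have h3 := h.lower_left hℓ.le a x p
  have h4 := (abs_le.1 (abs_real_inner_le_norm (gradX f a p) (x - a))).1
  have h5 := mul_le_mul_of_nonneg_right hgx (norm_nonneg (x - a))
  rw [norm_sub_rev a x, sub_self, norm_zero] at h1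
  -- Quadratic growth between `x` and `a` contributes `3ℓ/2 ‖x - a‖²`, of which weak convexity of
  -- `f(·, p)` takes back `ℓ/2 ‖x - a‖²`.
  have h6 : ℓ * ‖x - a‖ ^ 2 ≤ δ * D + δ * ‖x - a‖ := by nlinarith
  have h7 : (2 * ℓ * ‖x - a‖) ^ 2 ≤ 4 * ε ^ 2 + 2 * ε ^ 2 * (2 * ℓ * ‖x - a‖) := by
    have h8 := mul_le_mul_of_nonneg_left h6 hℓ.le
    have h9 := mul_le_mul_of_nonneg_right hδ1 (mul_nonneg hℓ.le (norm_nonneg (x - a)))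
    nlinarith
  -- With `t = 2ℓ‖x - a‖`, the bound reads `t² ≤ 4ε² + 2ε²t`, which is impossible for `t > 4ε² +
  -- 4ε`.
  by_contra! hlt
  nlinarith [sq_nonneg ε]

end Saddle

/-! ### Hilbert space inequalities, including the extragradient step. -/

section InnerProduct

theorem norm_add_sq_le_two {E : Type*} [SeminormedAddCommGroup E] (u v : E) : ‖u + v‖ ^ 2 ≤ 2 * (‖u‖ ^ 2 + ‖v‖ ^ 2) := by
  have := norm_add_le u v
  nlinarith [norm_nonneg (u + v), sq_nonneg (‖u‖ - ‖v‖)]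

theorem norm_add_sub_sq_le_three {E : Type*} [SeminormedAddCommGroup E] (u v w : E) :
    ‖u + v - w‖ ^ 2 ≤ 3 * (‖u‖ ^ 2 + ‖v‖ ^ 2 + ‖w‖ ^ 2) := by
  have h1 := (norm_sub_le (u + v) w).trans (add_le_add_left (norm_add_le u v) _)
  nlinarith [norm_nonneg (u + v - w), sq_nonneg (‖u‖ - ‖v‖), sq_nonneg (‖u‖ - ‖w‖),
    sq_nonneg (‖v‖ - ‖w‖)]

variable {E : Type*} [NormedAddCommGroup E] [InnerProductSpace ℝ E]

/-- Jensen's inequality for the squared norm of an average. -/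
theorem norm_average_sq_le (T : ℕ) (v : ℕ → E) :
    ‖(T : ℝ)⁻¹ • ∑ k ∈ Finset.range T, v k‖ ^ 2
      ≤ (T : ℝ)⁻¹ * ∑ k ∈ Finset.range T, ‖v k‖ ^ 2 := by
  rcases T.eq_zero_or_pos with rfl | hT
  · simp
  have hT' : (0 : ℝ) < T := by exact_mod_cast hT
  have h1 : ‖∑ k ∈ Finset.range T, v k‖ ^ 2 ≤ T * ∑ k ∈ Finset.range T, ‖v k‖ ^ 2 := by
    refine (pow_le_pow_left₀ (norm_nonneg _) (norm_sum_le _ _) 2).trans ?_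
    simpa using sq_sum_le_card_mul_sum_sq (s := Finset.range T) (f := fun k => ‖v k‖)
  rw [norm_smul, mul_pow, norm_inv, Real.norm_natCast, inv_pow, inv_mul_le_iff₀ (by positivity)]
  calc _ ≤ _ := h1
    _ = _ := by field_simp

/-- One extragradient step, for projections onto a convex set that contains `u` and `z'`. -/
theorem extragradient_step {z w z' u g₁ g₂ : E} {η : ℝ}
    (h₁ : inner ℝ (z - η • g₁ - w) (z' - w) ≤ 0) (h₂ : inner ℝ (z - η • g₂ - z') (u - z') ≤ 0) :
    2 * η * inner ℝ g₂ (w - u) ≤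
      ‖z - u‖ ^ 2 - ‖z' - u‖ ^ 2 - ‖w - z‖ ^ 2 + η ^ 2 * ‖g₂ - g₁‖ ^ 2 := by
  -- In the increments `A = w - z`, `B = z' - w` and `C = z' - u`, the claim is a linear combination
  -- of the two projection inequalities and of `0 ≤ ‖B + η(g₂ - g₁)‖²`.
  obtain ⟨A, rfl⟩ : ∃ A, w = z + A := ⟨w - z, by abel⟩
  obtain ⟨B, rfl⟩ : ∃ B, z' = z + A + B := ⟨z' - (z + A), by abel⟩
  obtain ⟨C, rfl⟩ : ∃ C, u = z + A + B - C := ⟨z + A + B - u, by abel⟩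
  have e1 : z - η • g₁ - (z + A) = -(A + η • g₁) := by abel
  have e2 : z + A + B - (z + A) = B := by abel
  have e3 : z - η • g₂ - (z + A + B) = -(A + B + η • g₂) := by abel
  have e4 : z + A + B - C - (z + A + B) = -C := by abel
  have e5 : z + A - (z + A + B - C) = C - B := by abel
  have e6 : z - (z + A + B - C) = C - (A + B) := by abel
  have e7 : z + A + B - (z + A + B - C) = C := by abel
  have e8 : z + A - z = A := by abel
  have h3 : 0 ≤ ‖B + η • (g₂ - g₁)‖ ^ 2 := sq_nonneg _
  rw [e1, e2] at h₁
  rw [e3, e4, inner_neg_neg] at h₂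
  rw [e5, e6, e7, e8, norm_sub_sq_real, norm_add_sq_real]
  rw [norm_add_sq_real, norm_smul, mul_pow, Real.norm_eq_abs, sq_abs] at h3
  simp only [inner_add_left, inner_add_right, inner_sub_right, inner_neg_left,
    inner_smul_left, inner_smul_right, conj_trivial] at h₁ h₂ h3 ⊢
  rw [real_inner_comm C A, real_inner_comm C B] at *
  rw [real_inner_comm g₁ B, real_inner_comm g₂ B] at *
  linarith

end InnerProduct

/-! ### Descent of the extragradient step, and near-stationarity of averages. -/

section Extragradient

variable {m n : ℕ} {ℓ D : ℝ} {Y : Set (Euc n)} {f : Euc m → Euc n → ℝ}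

/-- The gradient of `f (x, y) + ℓ ‖x - a‖²` in `x`. -/
noncomputable def regGradX (ℓ : ℝ) (f : Euc m → Euc n → ℝ) (a : Euc m) (z : Euc m × Euc n) :
    Euc m :=
  gradX f z.1 z.2 + (2 * ℓ) • (z.1 - a)

/-- A projected gradient step for `f (x, y) + ℓ ‖x - a‖²` from `z`, where `g` is (an estimate of)
the gradient of `f` at `w`. -/
noncomputable def proxStep (ℓ η : ℝ) (Y : Set (Euc n)) (a : Euc m) (z w g : Euc m × Euc n) :
    Euc m × Euc n :=
  (z.1 - η • (g.1 + (2 * ℓ) • (w.1 - a)), projSet Y (z.2 + η • g.2))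

theorem IsSmoothConcave.norm_regGradX_sub_le (h : IsSmoothConcave ℓ Y f) (hℓ : 0 ≤ ℓ) (a : Euc m)
    (x x' : Euc m) (y : Euc n) :
    ‖regGradX ℓ f a (x, y) - regGradX ℓ f a (x', y)‖ ≤ 3 * ℓ * ‖x - x'‖ := by
  have e : regGradX ℓ f a (x, y) - regGradX ℓ f a (x', y)
      = (gradX f x y - gradX f x' y) + (2 * ℓ) • (x - x') := by
    simp only [regGradX, smul_sub]; abel
  rw [e]
  refine (norm_add_le _ _).trans ?_
  rw [norm_smul, Real.norm_of_nonneg (by positivity)]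
  linarith [h.norm_gradX_sub_le_left hℓ x x' y]

namespace IsProxSaddle

variable {a x : Euc m} {y : Euc n}

/-- The monotone operator of the regularized problem dominates the gap at the saddle point. -/
theorem gap_le (hs : IsProxSaddle ℓ Y f a x y) (h : IsSmoothConcave ℓ Y f) (hℓ : 0 < ℓ)
    {w : Euc m × Euc n} (hw : w.2 ∈ Y) :
    ℓ * ‖w.1 - x‖ ^ 2 + (f x y - f x w.2) ≤
      inner ℝ (regGradX ℓ f a w) (w.1 - x) - inner ℝ (gradY f w.1 w.2) (w.2 - y) := by
  have h1 := h.regularized_lower_left hℓ.le a w.1 x w.2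
  have h2 := h.regularized_lower_left hℓ.le a x w.1 y
  have h3 := h.concave_right w.1 hw hs.mem
  rw [hs.gradX_eq, inner_zero_left] at h2
  rw [← neg_sub w.1 x, inner_neg_right, norm_neg] at h1
  rw [← neg_sub w.2 y, inner_neg_right] at h3
  simp only [regGradX]
  linarith

/-- The decrease of the distance to the saddle point in one stochastic extragradient step. -/
theorem extragradient_descent (hs : IsProxSaddle ℓ Y f a x y) (h : IsSmoothConcave ℓ Y f)
    (hℓ : 0 < ℓ) (hY : IsConstraintSet D Y) {η : ℝ} (hη : 0 < η) (hηℓ : 30 * η ^ 2 * ℓ ^ 2 ≤ 1)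
    {z w z' g₁ g₂ n₁ n₂ : Euc m × Euc n} (hw : w = proxStep ℓ η Y a z z g₁)
    (hz' : z' = proxStep ℓ η Y a z w g₂) (hn₁ : n₁ = g₁ - gradPair f z)
    (hn₂ : n₂ = g₂ - gradPair f w) :
    2 * η * (ℓ * ‖w.1 - x‖ ^ 2 + (f x y - f x w.2))
      + 2 * η * (inner ℝ n₂.1 (w.1 - x) - inner ℝ n₂.2 (w.2 - y))
      + (‖z'.1 - x‖ ^ 2 + ‖z'.2 - y‖ ^ 2) ≤
    ‖z.1 - x‖ ^ 2 + ‖z.2 - y‖ ^ 2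
      + 3 * η ^ 2 * ((‖n₁.1‖ ^ 2 + ‖n₁.2‖ ^ 2) + (‖n₂.1‖ ^ 2 + ‖n₂.2‖ ^ 2)) := by
  have hw2 : w.2 ∈ Y := by rw [hw]; exact hY.projSet_mem _
  have hz2 : z'.2 ∈ Y := by rw [hz']; exact hY.projSet_mem _
  have hg1 : g₁.1 = n₁.1 + gradX f z.1 z.2 := by rw [hn₁]; simp [gradPair]
  have hg2 : g₁.2 = n₁.2 + gradY f z.1 z.2 := by rw [hn₁]; simp [gradPair]
  have hg3 : g₂.1 = n₂.1 + gradX f w.1 w.2 := by rw [hn₂]; simp [gradPair]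
  have hg4 : g₂.2 = n₂.2 + gradY f w.1 w.2 := by rw [hn₂]; simp [gradPair]
  -- The `x` block is unconstrained, so its projection inequalities hold trivially; the `y` block
  -- ascends, hence the negated gradients.
  have hX := extragradient_step (z := z.1) (w := w.1) (z' := z'.1) (u := x) (η := η)
    (g₁ := n₁.1 + regGradX ℓ f a z) (g₂ := n₂.1 + regGradX ℓ f a w)
    (by rw [show z.1 - η • (n₁.1 + regGradX ℓ f a z) - w.1 = 0 by
          rw [hw]; simp [proxStep, regGradX, hg1, add_assoc]]
        simp)
    (by rw [show z.1 - η • (n₂.1 + regGradX ℓ f a w) - z'.1 = 0 by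
          rw [hz']; simp [proxStep, regGradX, hg3, add_assoc]]
        simp)
  have hYs := extragradient_step (z := z.2) (w := w.2) (z' := z'.2) (u := y) (η := η)
    (g₁ := -g₁.2) (g₂ := -g₂.2)
    (by have := hY.inner_projSet_le (z.2 + η • g₁.2) hz2
        rw [smul_neg, sub_neg_eq_add]
        rw [hw]
        exact this)
    (by have := hY.inner_projSet_le (z.2 + η • g₂.2) hs.mem
        rw [smul_neg, sub_neg_eq_add]
        rw [hz']
        exact this)
  have hgap := hs.gap_le h hℓ hw2
  have hd1 : ‖n₂.1 + regGradX ℓ f a w - (n₁.1 + regGradX ℓ f a z)‖ ^ 2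
      ≤ 3 * (‖regGradX ℓ f a w - regGradX ℓ f a z‖ ^ 2 + ‖n₂.1‖ ^ 2 + ‖n₁.1‖ ^ 2) := by
    refine le_trans (le_of_eq ?_) (norm_add_sub_sq_le_three _ _ _)
    congr 2; abel
  have hd2 : ‖-g₂.2 - -g₁.2‖ ^ 2
      ≤ 3 * (‖gradY f z.1 z.2 - gradY f w.1 w.2‖ ^ 2 + ‖n₁.2‖ ^ 2 + ‖n₂.2‖ ^ 2) := by
    refine le_trans (le_of_eq ?_) (norm_add_sub_sq_le_three _ _ _)
    rw [hg2, hg4]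
    congr 2; abel
  have hd3 : ‖regGradX ℓ f a w - regGradX ℓ f a z‖ ^ 2
      ≤ 2 * (‖gradX f z.1 z.2 - gradX f w.1 w.2‖ ^ 2 + 4 * ℓ ^ 2 * ‖w.1 - z.1‖ ^ 2) := by
    have e : regGradX ℓ f a w - regGradX ℓ f a z
        = (gradX f w.1 w.2 - gradX f z.1 z.2) + (2 * ℓ) • (w.1 - z.1) := by
      simp only [regGradX, smul_sub]; abel
    rw [e]
    refine (norm_add_sq_le_two _ _).trans (le_of_eq ?_)
    rw [norm_smul, Real.norm_of_nonneg (by positivity), norm_sub_rev (gradX f w.1 w.2)]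
    ring
  have hlip := h.sq_norm_grad_sub_le z.1 w.1 z.2 w.2
  rw [norm_sub_rev z.1, norm_sub_rev z.2] at hlip
  have hη2 : 0 < η ^ 2 := by positivity
  -- The factor `30` is `6 + 24`: `3·2` from the joint Lipschitz bound and `3·2·4` from the
  -- regularizer. The assumption on `η` lets `-‖w - z‖²` absorb it.
  have hsum : ‖n₂.1 + regGradX ℓ f a w - (n₁.1 + regGradX ℓ f a z)‖ ^ 2 + ‖-g₂.2 - -g₁.2‖ ^ 2
      ≤ 30 * ℓ ^ 2 * (‖w.1 - z.1‖ ^ 2 + ‖w.2 - z.2‖ ^ 2)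
        + 3 * ((‖n₁.1‖ ^ 2 + ‖n₁.2‖ ^ 2) + (‖n₂.1‖ ^ 2 + ‖n₂.2‖ ^ 2)) := by
    nlinarith [sq_nonneg ‖gradY f z.1 z.2 - gradY f w.1 w.2‖,
      mul_nonneg (sq_nonneg ℓ) (sq_nonneg ‖w.2 - z.2‖)]
  have hsum2 := mul_le_mul_of_nonneg_left hsum hη2.le
  have hfin := mul_le_mul_of_nonneg_right hηℓ
    (add_nonneg (sq_nonneg ‖w.1 - z.1‖) (sq_nonneg ‖w.2 - z.2‖))
  have hgap2 := mul_le_mul_of_nonneg_left hgap (by positivity : 0 ≤ 2 * η)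
  rw [inner_add_left] at hX
  rw [inner_neg_left, hg4, inner_add_left] at hYs
  rw [hg4] at hsum2
  linarith

end IsProxSaddle

theorem Convex.range_average_mem {E : Type*} [NormedAddCommGroup E] [NormedSpace ℝ E] {s : Set E}
    (hs : Convex ℝ s) {T : ℕ} (hT : 0 < T) {v : ℕ → E} (hv : ∀ k < T, v k ∈ s) :
    (T : ℝ)⁻¹ • ∑ k ∈ Finset.range T, v k ∈ s := by
  rw [Finset.smul_sum]
  refine hs.sum_mem (fun _ _ => by positivity) ?_ fun k hk => hv k (Finset.mem_range.1 hk)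
  simp [hT.ne']

theorem ConcaveOn.range_average_le {E : Type*} [NormedAddCommGroup E] [NormedSpace ℝ E] {s : Set E}
    {g : E → ℝ} (hg : ConcaveOn ℝ s g) {T : ℕ} (hT : 0 < T) {v : ℕ → E}
    (hv : ∀ k < T, v k ∈ s) :
    (T : ℝ)⁻¹ * ∑ k ∈ Finset.range T, g (v k) ≤ g ((T : ℝ)⁻¹ • ∑ k ∈ Finset.range T, v k) := by
  rw [Finset.smul_sum, Finset.mul_sum]
  refine hg.le_map_sum (fun _ _ => by positivity) ?_ fun k hk => hv k (Finset.mem_range.1 hk)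
  simp [hT.ne']

namespace IsProxSaddle

variable {a x : Euc m} {y : Euc n}

/-- An average of points with a small average gap and a small average gradient in `x` is almost
stationary. -/
theorem average_bounds (hs : IsProxSaddle ℓ Y f a x y) (h : IsSmoothConcave ℓ Y f)
    (hℓ : 0 < ℓ) (hY : IsConstraintSet D Y) {T : ℕ} (hT : 0 < T) {w : ℕ → Euc m × Euc n}
    (hw : ∀ k < T, (w k).2 ∈ Y) {A B C ε : ℝ} (hε : 2 * ℓ * ‖x - a‖ ≤ ε)
    (hA : (T : ℝ)⁻¹ * ∑ k ∈ Finset.range T, ‖(w k).1 - x‖ ^ 2 = A)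
    (hB : (T : ℝ)⁻¹ * ∑ k ∈ Finset.range T, (f x y - f x (w k).2) = B)
    (hC : ‖(T : ℝ)⁻¹ • ∑ k ∈ Finset.range T, regGradX ℓ f a (w k)‖ ^ 2 = C) {xb : Euc m}
    {yb : Euc n} (hxb : xb = (T : ℝ)⁻¹ • ∑ k ∈ Finset.range T, (w k).1)
    (hyb : yb = (T : ℝ)⁻¹ • ∑ k ∈ Finset.range T, (w k).2) :
    yb ∈ Y ∧ ℓ ^ 2 * ‖ascentStep ℓ Y f xb yb - yb‖ ^ 2 ≤ 4 * (ℓ * B) + 2 * (ℓ ^ 2 * A) ∧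
    ‖gradX f xb (ascentStep ℓ Y f xb yb)‖ ^ 2
      ≤ 4 * (ε ^ 2 + 4 * C + 39 * (ℓ ^ 2 * A) + 12 * (ℓ * B)) := by
  have hT' : (0 : ℝ) < T := by exact_mod_cast hT
  have hybY : yb ∈ Y := hyb ▸ hY.convex.range_average_mem (v := fun k => (w k).2) hT hw
  have havg : ∀ c : ℝ, (T : ℝ)⁻¹ * ∑ k ∈ Finset.range T, c = c := fun c => by
    simp [hT.ne']
  have havgv : ∀ c : Euc m, (T : ℝ)⁻¹ • ∑ k ∈ Finset.range T, c = c := fun c => by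
    rw [Finset.sum_const, Finset.card_range, ← Nat.cast_smul_eq_nsmul ℝ, smul_smul,
      inv_mul_cancel₀ hT'.ne', one_smul]
  have hu : ‖xb - x‖ ^ 2 ≤ A := by
    have := norm_average_sq_le T fun k => (w k).1 - x
    rwa [Finset.sum_sub_distrib, smul_sub, havgv, ← hxb, hA] at this
  have hBf : (T : ℝ)⁻¹ * ∑ k ∈ Finset.range T, f x (w k).2 = f x y - B := by
    rw [← hB, Finset.sum_sub_distrib, mul_sub, havg]; ring
  have hgapy : f x y - f x yb ≤ B := by
    have := (h.concave x).range_average_le (v := fun k => (w k).2) hT hw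
    rw [← hyb, hBf] at this
    linarith
  set p := ascentStep ℓ Y f xb yb with hp
  -- The ascent step is first controlled at the saddle value `x`, where its length is bounded by the
  -- gap; moving from `x` to `xb` shifts it by at most `‖xb - x‖`.
  set q := ascentStep ℓ Y f x yb with hq
  have hqY : q ∈ Y := hY.projSet_mem _
  have hqb : ℓ * ‖q - yb‖ ^ 2 ≤ 2 * B := by
    have h1 := h.le_ascentStep_add hℓ hY x hybY hybY
    rw [sub_self, inner_zero_right] at h1
    have h2 := hs.le_max q hqY
    linarith
  have hpq : ‖p - q‖ ≤ ‖xb - x‖ := by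
    refine (hY.norm_projSet_sub_le _ _).trans ?_
    rw [add_sub_add_left_eq_sub, ← smul_sub, norm_smul, Real.norm_of_nonneg (by positivity)]
    have := h.norm_gradY_sub_le_left hℓ.le xb x yb
    rw [one_div, inv_mul_le_iff₀ hℓ]
    exact this
  have hstep : ℓ ^ 2 * ‖p - yb‖ ^ 2 ≤ 4 * (ℓ * B) + 2 * (ℓ ^ 2 * A) := by
    have h1 : ‖p - yb‖ ^ 2 ≤ 2 * (‖p - q‖ ^ 2 + ‖q - yb‖ ^ 2) := by
      rw [← sub_add_sub_cancel p q yb]; exact norm_add_sq_le_two _ _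
    have h2 : ‖p - q‖ ^ 2 ≤ A := (pow_le_pow_left₀ (norm_nonneg _) hpq 2).trans hu
    have h3 := mul_le_mul_of_nonneg_left hqb hℓ.le
    have h4 := mul_le_mul_of_nonneg_left h1 (sq_nonneg ℓ)
    have h5 := mul_le_mul_of_nonneg_left h2 (sq_nonneg ℓ)
    linarith
  refine ⟨hybY, hstep, ?_⟩
  set γ := (T : ℝ)⁻¹ • ∑ k ∈ Finset.range T, regGradX ℓ f a (x, (w k).2) with hγ
  set P := regGradX ℓ f a (x, yb) with hP
  -- By concavity `f(x + d, yb)` is at least the mean of `f(x + d, y_k)`. Expanding both sides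
  -- around `x` gives `⟨γ - P, d⟩ ≤ B + ℓ‖d‖²`, where `ℓ = 3ℓ/2 - ℓ/2`; the chosen `d` optimizes
  -- this.
  have hγP : ‖γ - P‖ ^ 2 ≤ 4 * (ℓ * B) := by
    set d := (1 / (2 * ℓ)) • (γ - P) with hd
    have h1 := (h.concave (x + d)).range_average_le (v := fun k => (w k).2) hT hw
    rw [← hyb] at h1
    have h2 := h.regularized_upper_left hℓ.le a x (x + d) yb
    have h3 : (T : ℝ)⁻¹ * ∑ k ∈ Finset.range T, (f x (w k).2 + ℓ * ‖x - a‖ ^ 2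
        + inner ℝ (regGradX ℓ f a (x, (w k).2)) d + ℓ / 2 * ‖d‖ ^ 2) ≤
        (T : ℝ)⁻¹ * ∑ k ∈ Finset.range T, (f (x + d) (w k).2 + ℓ * ‖x + d - a‖ ^ 2) := by
      refine mul_le_mul_of_nonneg_left (Finset.sum_le_sum fun k _ => ?_) (by positivity)
      simpa [regGradX] using h.regularized_lower_left hℓ.le a x (x + d) (w k).2
    rw [Finset.sum_add_distrib, Finset.sum_add_distrib, Finset.sum_add_distrib,
      Finset.sum_add_distrib, mul_add, mul_add, mul_add, mul_add, havg, havg, havg, hBf,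
      ← sum_inner] at h3
    have h4 : inner ℝ γ d
        = (T : ℝ)⁻¹ * inner ℝ (∑ k ∈ Finset.range T, regGradX ℓ f a (x, (w k).2)) d := by
      rw [hγ, inner_smul_left, conj_trivial]
    rw [← h4] at h3
    rw [add_sub_cancel_left] at h2
    change _ ≤ _ + inner ℝ P d + _ at h2
    have h5 := hs.le_max yb hybY
    have h6 : inner ℝ (γ - P) d ≤ B + ℓ * ‖d‖ ^ 2 := by
      rw [inner_sub_left]; linarith
    rw [hd, inner_smul_right, real_inner_self_eq_norm_sq, norm_smul, mul_pow,
      Real.norm_of_nonneg (by positivity)] at h6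
    have h7 := mul_le_mul_of_nonneg_left h6 (by positivity : 0 ≤ 4 * ℓ)
    have e1 : 4 * ℓ * (1 / (2 * ℓ) * ‖γ - P‖ ^ 2) = 2 * ‖γ - P‖ ^ 2 := by field_simp; ring
    have e2 : 4 * ℓ * (B + ℓ * ((1 / (2 * ℓ)) ^ 2 * ‖γ - P‖ ^ 2))
        = 4 * (ℓ * B) + ‖γ - P‖ ^ 2 := by field_simp; ring
    rw [e1, e2] at h7
    linarith
  have hγC : ‖γ‖ ^ 2 ≤ 2 * C + 18 * (ℓ ^ 2 * A) := by
    have e : γ = (T : ℝ)⁻¹ • ∑ k ∈ Finset.range T, regGradX ℓ f a (w k) +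
        (T : ℝ)⁻¹ • ∑ k ∈ Finset.range T,
          (regGradX ℓ f a (x, (w k).2) - regGradX ℓ f a (w k)) := by
      rw [← smul_add, ← Finset.sum_add_distrib]
      simp only [add_sub_cancel, hγ]
    have h1 : (T : ℝ)⁻¹ * ∑ k ∈ Finset.range T,
        ‖regGradX ℓ f a (x, (w k).2) - regGradX ℓ f a (w k)‖ ^ 2 ≤ 9 * (ℓ ^ 2 * A) := by
      have e' : 9 * (ℓ ^ 2 * A)
          = (T : ℝ)⁻¹ * ∑ k ∈ Finset.range T, 9 * ℓ ^ 2 * ‖(w k).1 - x‖ ^ 2 := by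
        rw [← hA, ← Finset.mul_sum]; ring
      rw [e']
      refine mul_le_mul_of_nonneg_left (Finset.sum_le_sum fun k _ => ?_) (by positivity)
      have h2 := h.norm_regGradX_sub_le hℓ.le a x (w k).1 (w k).2
      refine (pow_le_pow_left₀ (norm_nonneg _) h2 2).trans (le_of_eq ?_)
      rw [norm_sub_rev]; ring
    rw [e]
    refine (norm_add_sq_le_two _ _).trans ?_
    have h2 := norm_average_sq_le T fun k => regGradX ℓ f a (x, (w k).2) - regGradX ℓ f a (w k)
    linarith
  have hPb : ‖P‖ ^ 2 ≤ 4 * C + 36 * (ℓ ^ 2 * A) + 8 * (ℓ * B) := by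
    have h1 := norm_add_sq_le_two (P - γ) γ
    rw [sub_add_cancel, norm_sub_rev] at h1
    linarith
  have hgrad : ‖gradX f xb p‖ ≤ ε + ‖P‖ + ℓ * ‖xb - x‖ + ℓ * ‖p - yb‖ := by
    have h1 := h.norm_gradX_sub_le hℓ.le xb x p yb
    have h2 : gradX f xb p = (gradX f xb p - gradX f x yb) + (P - (2 * ℓ) • (x - a)) := by
      rw [hP, regGradX]; abel
    have h3 : ‖(2 * ℓ) • (x - a)‖ ≤ ε := by
      rwa [norm_smul, Real.norm_of_nonneg (by positivity)]
    have h4 := norm_add_le (gradX f xb p - gradX f x yb) (P - (2 * ℓ) • (x - a))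
    rw [← h2] at h4
    have h5 := norm_sub_le P ((2 * ℓ) • (x - a))
    linarith
  have hfour : ∀ r s t u : ℝ, (r + s + t + u) ^ 2 ≤ 4 * (r ^ 2 + s ^ 2 + t ^ 2 + u ^ 2) := by
    intro r s t u
    nlinarith [sq_nonneg (r - s), sq_nonneg (r - t), sq_nonneg (r - u), sq_nonneg (s - t),
      sq_nonneg (s - u), sq_nonneg (t - u)]
  refine (pow_le_pow_left₀ (norm_nonneg _) hgrad 2).trans ((hfour _ _ _ _).trans ?_)
  have h1 := mul_le_mul_of_nonneg_left hu (sq_nonneg ℓ)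
  rw [mul_pow, mul_pow]
  linarith

end IsProxSaddle

end Extragradient

/-! ### Oracle methods that carry a state. -/

section StatefulMethod

variable {V S : Type*}

/-- The state reached from `s₀` after the given answers. -/
def foldState (s₀ : S) (step : ℕ → S → V → S) : (k : ℕ) → (Fin k → V) → S
  | 0, _ => s₀
  | k + 1, ans => step k (foldState s₀ step k (Fin.init ans)) (ans (Fin.last k))

/-- The states of the run of a stateful rule against an oracle. -/
def runState (s₀ : S) (q : ℕ → S → V) (step : ℕ → S → V → S) (oracle : ℕ → V → V) : ℕ → S
  | 0 => s₀
  | k + 1 => step k (runState s₀ q step oracle k) (oracle k (q k (runState s₀ q step oracle k)))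

/-- The oracle method that keeps a state. -/
def statefulMethod (N : ℕ) (s₀ : S) (q : ℕ → S → V) (step : ℕ → S → V → S) (out : S → V) :
    OracleMethod V N where
  query k ans := q k (foldState s₀ step k ans)
  output ans := out (foldState s₀ step N ans)

/-- A method sees only the list of answers, so it rebuilds its state from that list before every
query; against an oracle this reproduces the recursive run. -/
theorem foldState_answers (N : ℕ) (s₀ : S) (q : ℕ → S → V) (step : ℕ → S → V → S) (out : S → V)
    (oracle : ℕ → V → V) (k : ℕ) :
    foldState s₀ step k ((statefulMethod N s₀ q step out).answers oracle k)
      = runState s₀ q step oracle k := by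
  induction k with
  | zero => rfl
  | succ k ih =>
    simp only [OracleMethod.answers, foldState, runState, Fin.init_snoc, Fin.snoc_last, ih]
    simp only [statefulMethod] at ih ⊢
    rw [ih]

theorem statefulMethod_result (N : ℕ) (s₀ : S) (q : ℕ → S → V) (step : ℕ → S → V → S)
    (out : S → V) (oracle : ℕ → V → V) :
    (statefulMethod N s₀ q step out).result oracle = out (runState s₀ q step oracle N) := by
  rw [← foldState_answers N s₀ q step out oracle N]; rfl

variable [MeasurableSpace V] [MeasurableSpace S]

theorem measurable_foldState (s₀ : S) {step : ℕ → S → V → S}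
    (hstep : ∀ k, Measurable fun p : S × V => step k p.1 p.2) (k : ℕ) :
    Measurable (foldState s₀ step k) := by
  induction k with
  | zero => exact measurable_const
  | succ k ih =>
    have h1 : Measurable fun ans : Fin (k + 1) → V => (Fin.init ans : Fin k → V) :=
      measurable_pi_lambda _ fun i => measurable_pi_apply _
    exact (hstep k).comp ((ih.comp h1).prodMk (measurable_pi_apply _))

theorem statefulMethod_isMeasurable (N : ℕ) (s₀ : S) {q : ℕ → S → V} {step : ℕ → S → V → S}
    {out : S → V} (hq : ∀ k, Measurable (q k))
    (hstep : ∀ k, Measurable fun p : S × V => step k p.1 p.2) (hout : Measurable out) :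
    (statefulMethod N s₀ q step out).IsMeasurable :=
  ⟨fun k => (hq k).comp (measurable_foldState s₀ hstep k),
    hout.comp (measurable_foldState s₀ hstep N)⟩

end StatefulMethod

/-! ### The extragradient method as an oracle method. -/

section ExtragradientMethod

variable {m n : ℕ}

/-- The query of the extragradient method in the state `(z, w, sum)`. -/
def egQuery {V : Type*} (k : ℕ) (s : V × V × V) : V :=
  if Even k then s.1 else s.2.1

/-- The update of the state `(z, w, sum)` of the extragradient method. -/
noncomputable def egUpdate (ℓ η : ℝ) (Y : Set (Euc n)) (a : Euc m) (k : ℕ)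
    (s : (Euc m × Euc n) × (Euc m × Euc n) × (Euc m × Euc n)) (g : Euc m × Euc n) :
    (Euc m × Euc n) × (Euc m × Euc n) × (Euc m × Euc n) :=
  if Even k then (s.1, proxStep ℓ η Y a s.1 s.1 g, s.2.2)
  else (proxStep ℓ η Y a s.1 s.2.1 g, s.2.1, s.2.2 + s.2.1)

/-- The extragradient method with `T` steps, which returns the average of the midpoints. -/
noncomputable def egMethod (ℓ η : ℝ) (Y : Set (Euc n)) (a : Euc m) (y₀ : Euc n) (T : ℕ) :
    OracleMethod (Euc m × Euc n) (2 * T) :=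
  statefulMethod (2 * T) ((a, y₀), (a, y₀), 0) egQuery (egUpdate ℓ η Y a)
    (fun s => (T : ℝ)⁻¹ • s.2.2)

/-- The states of the extragradient method. -/
noncomputable def egState (ℓ η : ℝ) (Y : Set (Euc n)) (a : Euc m) (y₀ : Euc n)
    (oracle : ℕ → Euc m × Euc n → Euc m × Euc n) (k : ℕ) :
    (Euc m × Euc n) × (Euc m × Euc n) × (Euc m × Euc n) :=
  runState ((a, y₀), (a, y₀), 0) egQuery (egUpdate ℓ η Y a) oracle k

variable (ℓ η : ℝ) (Y : Set (Euc n)) (a : Euc m) (y₀ : Euc n)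
  (oracle : ℕ → Euc m × Euc n → Euc m × Euc n)

/-- Two oracle calls make one step: the call with even index, at the base point, yields the
midpoint; the call with odd index, at the midpoint, moves the base point and adds the midpoint to
the sum. -/
theorem egState_odd (k : ℕ) : egState ℓ η Y a y₀ oracle (2 * k + 1) =
    ((egState ℓ η Y a y₀ oracle (2 * k)).1,
      proxStep ℓ η Y a (egState ℓ η Y a y₀ oracle (2 * k)).1 (egState ℓ η Y a y₀ oracle (2 * k)).1
        (oracle (2 * k) (egState ℓ η Y a y₀ oracle (2 * k)).1),
      (egState ℓ η Y a y₀ oracle (2 * k)).2.2) := by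
  simp [egState, runState, egUpdate, egQuery]

theorem egState_even (k : ℕ) : egState ℓ η Y a y₀ oracle (2 * (k + 1)) =
    (proxStep ℓ η Y a (egState ℓ η Y a y₀ oracle (2 * k)).1
        (egState ℓ η Y a y₀ oracle (2 * k + 1)).2.1
        (oracle (2 * k + 1) (egState ℓ η Y a y₀ oracle (2 * k + 1)).2.1),
      (egState ℓ η Y a y₀ oracle (2 * k + 1)).2.1,
      (egState ℓ η Y a y₀ oracle (2 * k)).2.2 + (egState ℓ η Y a y₀ oracle (2 * k + 1)).2.1) := by
  have h1 : (egState ℓ η Y a y₀ oracle (2 * k + 1)).1 = (egState ℓ η Y a y₀ oracle (2 * k)).1 := by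
    rw [egState_odd]
  have h2 : (egState ℓ η Y a y₀ oracle (2 * k + 1)).2.2
      = (egState ℓ η Y a y₀ oracle (2 * k)).2.2 := by
    rw [egState_odd]
  have h3 : ¬ Even (2 * k + 1) := by simp
  rw [← h1, ← h2]
  change runState _ _ _ _ (2 * k + 1 + 1) = _
  rw [runState]
  simp only [egUpdate, egQuery, if_neg h3]
  rfl

theorem egState_sum (k : ℕ) : (egState ℓ η Y a y₀ oracle (2 * k)).2.2 =
    ∑ j ∈ Finset.range k, (egState ℓ η Y a y₀ oracle (2 * j + 1)).2.1 := by
  induction k with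
  | zero => rfl
  | succ k ih => rw [egState_even, Finset.sum_range_succ, ← ih]

theorem egMethod_result (T : ℕ) : (egMethod ℓ η Y a y₀ T).result oracle =
    (T : ℝ)⁻¹ • ∑ j ∈ Finset.range T, (egState ℓ η Y a y₀ oracle (2 * j + 1)).2.1 := by
  rw [egMethod, statefulMethod_result, ← egState_sum]; rfl

variable {ℓ η Y a y₀}

theorem measurable_egQuery {V : Type*} [MeasurableSpace V] (k : ℕ) :
    Measurable (egQuery (V := V) k) := by
  unfold egQuery
  split_ifs <;> fun_prop

theorem measurable_egUpdate (hY : Measurable (projSet Y)) (k : ℕ) :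
    Measurable fun p : ((Euc m × Euc n) × (Euc m × Euc n) × (Euc m × Euc n)) × (Euc m × Euc n) =>
      egUpdate ℓ η Y a k p.1 p.2 := by
  unfold egUpdate proxStep
  split_ifs
  · have : Measurable fun p : ((Euc m × Euc n) × (Euc m × Euc n) × (Euc m × Euc n)) ×
        (Euc m × Euc n) => projSet Y (p.1.1.2 + η • p.2.2) := hY.comp (by fun_prop)
    fun_prop
  · have : Measurable fun p : ((Euc m × Euc n) × (Euc m × Euc n) × (Euc m × Euc n)) ×
        (Euc m × Euc n) => projSet Y (p.1.1.2 + η • p.2.2) := hY.comp (by fun_prop)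
    fun_prop

theorem egMethod_isMeasurable (hY : Measurable (projSet Y)) (T : ℕ) :
    (egMethod ℓ η Y a y₀ T).IsMeasurable :=
  statefulMethod_isMeasurable _ _ measurable_egQuery (measurable_egUpdate hY)
    (by fun_prop)

end ExtragradientMethod

/-- The starting point is stationary if the constraint set is small. -/
theorem IsSmoothConcave.isStationaryPair_of_diam_le {m n : ℕ} {ℓ D ε : ℝ} {Y : Set (Euc n)}
    {f : Euc m → Euc n → ℝ} (h : IsSmoothConcave ℓ Y f) (hℓ : 0 < ℓ) (hY : IsConstraintSet D Y)
    (hD : ℓ * D ≤ ε) (hε : 0 < ε) {a : Euc m} (ha : IsMoreauStationary ℓ (maxFun Y f) ε a)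
    {b : Euc n} (hb : b ∈ Y) : IsStationaryPair ℓ Y f (4 * ε) a b := by
  obtain ⟨x, y, hs⟩ := h.exists_isProxSaddle hℓ hY a
  rw [hs.isMoreauStationary_iff h hℓ hY] at ha
  have hp : ascentStep ℓ Y f a b ∈ Y := hY.projSet_mem _
  refine ⟨hb, ?_, ?_⟩
  -- The gradient is at most `ε + ε/2 + ε`: its norm at the saddle point, then `ℓ‖x - a‖`, then
  -- `ℓD`.
  · have h1 := h.norm_gradX_sub_le hℓ.le a x (ascentStep ℓ Y f a b) y
    have h2 : ‖gradX f x y‖ ≤ ε := by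
      rw [eq_neg_of_add_eq_zero_left hs.gradX_eq, norm_neg, norm_smul,
        Real.norm_of_nonneg (by positivity)]
      exact ha
    have h3 := norm_le_norm_sub_add (gradX f a (ascentStep ℓ Y f a b)) (gradX f x y)
    have h4 := hY.norm_sub_le hp hs.mem
    rw [norm_sub_rev a x] at h1
    nlinarith
  · rw [le_div_iff₀ hℓ]
    have h4 := hY.norm_sub_le hp hb
    nlinarith

/-! ### Summed descent and the error of the averaged output. -/

section Average

variable {m n : ℕ} {ℓ D : ℝ} {Y : Set (Euc n)} {f : Euc m → Euc n → ℝ}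

/-- The error of the answer `g` to the query `z`. -/
noncomputable def gradNoise (f : Euc m → Euc n → ℝ) (z g : Euc m × Euc n) : Euc m × Euc n :=
  g - gradPair f z

/-- The squared Euclidean norm of the error of the answer `g` to the query `z`. -/
noncomputable def gradNoiseSq (f : Euc m → Euc n → ℝ) (z g : Euc m × Euc n) : ℝ :=
  ‖(gradNoise f z g).1‖ ^ 2 + ‖(gradNoise f z g).2‖ ^ 2

/-- The component of the error of `g` along the direction from `(x, y)` to `z`. -/
noncomputable def gradNoiseInner (f : Euc m → Euc n → ℝ) (x : Euc m) (y : Euc n)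
    (z g : Euc m × Euc n) : ℝ :=
  inner ℝ (gradNoise f z g).1 (z.1 - x) - inner ℝ (gradNoise f z g).2 (z.2 - y)

/-- The right-hand side of the summed descent inequality. -/
noncomputable def descentBudget (f : Euc m → Euc n → ℝ) (η : ℝ) (x : Euc m) (y : Euc n)
    (z w g₁ g₂ : ℕ → Euc m × Euc n) (T : ℕ) : ℝ :=
  ‖(z 0).1 - x‖ ^ 2 + ‖(z 0).2 - y‖ ^ 2
    + 3 * η ^ 2 * ∑ k ∈ Finset.range T, (gradNoiseSq f (z k) (g₁ k) + gradNoiseSq f (w k) (g₂ k))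
    - 2 * η * ∑ k ∈ Finset.range T, gradNoiseInner f x y (w k) (g₂ k)

namespace IsProxSaddle

variable {a x : Euc m} {y : Euc n}

/-- The descent inequality telescopes. The final distance to the saddle point is kept on the left
because the bound on the mean gradient needs it. -/
theorem sum_extragradient_descent (hs : IsProxSaddle ℓ Y f a x y) (h : IsSmoothConcave ℓ Y f)
    (hℓ : 0 < ℓ) (hY : IsConstraintSet D Y) {η : ℝ} (hη : 0 < η) (hηℓ : 30 * η ^ 2 * ℓ ^ 2 ≤ 1)
    {z w g₁ g₂ : ℕ → Euc m × Euc n} (hw : ∀ k, w k = proxStep ℓ η Y a (z k) (z k) (g₁ k))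
    (hz : ∀ k, z (k + 1) = proxStep ℓ η Y a (z k) (w k) (g₂ k)) (T : ℕ) :
    2 * η * (ℓ * ∑ k ∈ Finset.range T, ‖(w k).1 - x‖ ^ 2
        + ∑ k ∈ Finset.range T, (f x y - f x (w k).2))
      + (‖(z T).1 - x‖ ^ 2 + ‖(z T).2 - y‖ ^ 2) ≤ descentBudget f η x y z w g₁ g₂ T := by
  induction T with
  | zero => simp [descentBudget]
  | succ T ih =>
    have h1 := hs.extragradient_descent h hℓ hY hη hηℓ (hw T) (hz T) rfl rfl
    change _ + 2 * η * gradNoiseInner f x y (w T) (g₂ T) + _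
      ≤ _ + 3 * η ^ 2 * (gradNoiseSq f (z T) (g₁ T) + gradNoiseSq f (w T) (g₂ T)) at h1
    simp only [descentBudget, Finset.sum_range_succ] at ih ⊢
    linarith

/-- The output of the extragradient method is almost stationary, up to the accumulated noise. -/
theorem extragradient_average_bounds (hs : IsProxSaddle ℓ Y f a x y) (h : IsSmoothConcave ℓ Y f)
    (hℓ : 0 < ℓ) (hY : IsConstraintSet D Y) {η : ℝ} (hη : 0 < η) (hηℓ : 30 * η ^ 2 * ℓ ^ 2 ≤ 1)
    {z w g₁ g₂ : ℕ → Euc m × Euc n} (hw : ∀ k, w k = proxStep ℓ η Y a (z k) (z k) (g₁ k))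
    (hz : ∀ k, z (k + 1) = proxStep ℓ η Y a (z k) (w k) (g₂ k)) {T : ℕ} (hT : 0 < T)
    {ε : ℝ} (hε : 2 * ℓ * ‖x - a‖ ≤ ε) {xb : Euc m}
    {yb : Euc n} (hxb : xb = (T : ℝ)⁻¹ • ∑ k ∈ Finset.range T, (w k).1)
    (hyb : yb = (T : ℝ)⁻¹ • ∑ k ∈ Finset.range T, (w k).2) :
    yb ∈ Y ∧
    ℓ ^ 2 * ‖ascentStep ℓ Y f xb yb - yb‖ ^ 2
      ≤ 2 * (ℓ / (η * T)) * descentBudget f η x y z w g₁ g₂ T ∧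
    ‖gradX f xb (ascentStep ℓ Y f xb yb)‖ ^ 2
      ≤ 4 * (ε ^ 2 + 16 * (1 / (η * T)) ^ 2 *
            (descentBudget f η x y z w g₁ g₂ T + (‖(z 0).1 - x‖ ^ 2 + ‖(z 0).2 - y‖ ^ 2))
          + 8 * (1 / (T : ℝ)) ^ 2 * ‖∑ k ∈ Finset.range T, (gradNoise f (w k) (g₂ k)).1‖ ^ 2
          + 20 * (ℓ / (η * T)) * descentBudget f η x y z w g₁ g₂ T) := by
  have hT' : (0 : ℝ) < T := by exact_mod_cast hT
  have hwY : ∀ k, (w k).2 ∈ Y := fun k => by rw [hw k]; exact hY.projSet_mem _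
  obtain ⟨h1, h2, h3⟩ := hs.average_bounds h hℓ hY hT (fun k _ => hwY k) hε rfl rfl rfl hxb hyb
  have hsum := hs.sum_extragradient_descent h hℓ hY hη hηℓ hw hz T
  set H := descentBudget f η x y z w g₁ g₂ T
  set a₀ := ‖(z 0).1 - x‖ ^ 2 + ‖(z 0).2 - y‖ ^ 2 with ha₀
  set SA := ∑ k ∈ Finset.range T, ‖(w k).1 - x‖ ^ 2
  set SB := ∑ k ∈ Finset.range T, (f x y - f x (w k).2)
  set S := ∑ k ∈ Finset.range T, (gradNoise f (w k) (g₂ k)).1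
  set C := ‖(T : ℝ)⁻¹ • ∑ k ∈ Finset.range T, regGradX ℓ f a (w k)‖ ^ 2
  have hSA : 0 ≤ SA := Finset.sum_nonneg fun _ _ => sq_nonneg _
  have hSB : 0 ≤ SB := Finset.sum_nonneg fun k _ => sub_nonneg.2 (hs.le_max _ (hwY k))
  have hAB : ℓ ^ 2 * ((T : ℝ)⁻¹ * SA) + ℓ * ((T : ℝ)⁻¹ * SB) ≤ (ℓ / (η * T)) / 2 * H := by
    have h4 : 2 * η * (ℓ * SA + SB) ≤ H := by
      linarith [sq_nonneg ‖(z T).1 - x‖, sq_nonneg ‖(z T).2 - y‖]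
    have h5 := mul_le_mul_of_nonneg_left h4 (by positivity : 0 ≤ ℓ / (η * T) / 2)
    refine le_trans (le_of_eq ?_) h5
    field_simp
  have hB0 : 0 ≤ ℓ * ((T : ℝ)⁻¹ * SB) := by positivity
  have hA0 : 0 ≤ ℓ ^ 2 * ((T : ℝ)⁻¹ * SA) := by positivity
  -- The unconstrained `x` updates telescope, so the mean gradient is a displacement divided by
  -- `ηT`, up to the mean noise.
  have htel : ∀ K : ℕ, η • ∑ k ∈ Finset.range K, regGradX ℓ f a (w k)
      = (z 0).1 - (z K).1 - η • ∑ k ∈ Finset.range K, (gradNoise f (w k) (g₂ k)).1 := by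
    intro K
    induction K with
    | zero => simp
    | succ K ih =>
      rw [Finset.sum_range_succ, Finset.sum_range_succ, smul_add, ih, hz K]
      simp only [proxStep, regGradX, gradNoise, gradPair, Prod.fst_sub, smul_add, smul_sub]
      abel
  have hC : C ≤ 4 * (1 / (η * T)) ^ 2 * (H + a₀) + 2 * (1 / (T : ℝ)) ^ 2 * ‖S‖ ^ 2 := by
    have e : (T : ℝ)⁻¹ • ∑ k ∈ Finset.range T, regGradX ℓ f a (w k)
        = (1 / (η * T)) • (((z 0).1 - x) + (x - (z T).1)) + (-(1 / (T : ℝ))) • S := by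
      rw [sub_add_sub_cancel, ← eq_sub_iff_add_eq.1 (htel T), smul_add, smul_smul, smul_smul,
        neg_smul]
      have e1 : 1 / (η * T) * η = (T : ℝ)⁻¹ := by field_simp
      rw [e1, one_div]
      abel
    have h4 := norm_add_sq_le_two ((1 / (η * T)) • (((z 0).1 - x) + (x - (z T).1)))
      ((-(1 / (T : ℝ))) • S)
    rw [← e, norm_smul (1 / (η * T)), norm_smul (-(1 / (T : ℝ))), mul_pow, mul_pow, norm_neg, Real.norm_of_nonneg (by positivity),
      Real.norm_of_nonneg (by positivity)] at h4
    have h5 := norm_add_sq_le_two ((z 0).1 - x) (x - (z T).1)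
    rw [norm_sub_rev x] at h5
    have h6 : ‖(z 0).1 - x + (x - (z T).1)‖ ^ 2 ≤ 2 * (H + a₀) := by
      have h7 : 0 ≤ 2 * η * (ℓ * SA + SB) := by positivity
      linarith [sq_nonneg ‖(z T).2 - y‖, sq_nonneg ‖(z 0).2 - y‖]
    have h7 := mul_le_mul_of_nonneg_left h6 (sq_nonneg (1 / (η * T)))
    linarith
  refine ⟨h1, ?_, ?_⟩ <;> linarith

/-- The output of the stochastic extragradient method is stationary in expectation. -/
theorem isStationaryPairInExpectation_average (hs : IsProxSaddle ℓ Y f a x y)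
    (h : IsSmoothConcave ℓ Y f) (hℓ : 0 < ℓ) (hY : IsConstraintSet D Y) {η : ℝ} (hη : 0 < η)
    (hηℓ : 30 * η ^ 2 * ℓ ^ 2 ≤ 1) {T : ℕ} (hT : 0 < T) {ε σ : ℝ} (hε : 0 < ε)
    (ha : 2 * ℓ * ‖x - a‖ ≤ ε) (hD : ε ≤ ℓ * D)
    (hηT : 1000 * (ℓ * D) ^ 2 ≤ η * T * (ℓ * ε ^ 2)) (hησ : η ^ 2 * T * σ ^ 2 ≤ 2 * D ^ 2)
    (hTσ : 10 ^ 6 * σ ^ 2 ≤ T * ε ^ 2) {y₀ : Euc n} (hy₀ : y₀ ∈ Y)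
    {Ω : Type*} [MeasurableSpace Ω] {μ : Measure Ω} [IsProbabilityMeasure μ]
    {Z W G₁ G₂ : ℕ → Ω → Euc m × Euc n} (hZ0 : ∀ ω, Z 0 ω = (a, y₀))
    (hW : ∀ k ω, W k ω = proxStep ℓ η Y a (Z k ω) (Z k ω) (G₁ k ω))
    (hZ : ∀ k ω, Z (k + 1) ω = proxStep ℓ η Y a (Z k ω) (W k ω) (G₂ k ω))
    (hWm : ∀ k, Measurable (W k))
    (hV₁i : ∀ k, Integrable (fun ω => gradNoiseSq f (Z k ω) (G₁ k ω)) μ)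
    (hV₁ : ∀ k, ∫ ω, gradNoiseSq f (Z k ω) (G₁ k ω) ∂μ ≤ σ ^ 2)
    (hV₂i : ∀ k, Integrable (fun ω => gradNoiseSq f (W k ω) (G₂ k ω)) μ)
    (hV₂ : ∀ k, ∫ ω, gradNoiseSq f (W k ω) (G₂ k ω) ∂μ ≤ σ ^ 2)
    (hMi : ∀ k, Integrable (fun ω => gradNoiseInner f x y (W k ω) (G₂ k ω)) μ)
    (hM : ∀ k, ∫ ω, gradNoiseInner f x y (W k ω) (G₂ k ω) ∂μ = 0)
    (hSi : Integrable
      (fun ω => ‖∑ k ∈ Finset.range T, (gradNoise f (W k ω) (G₂ k ω)).1‖ ^ 2) μ)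
    (hS : ∫ ω, ‖∑ k ∈ Finset.range T, (gradNoise f (W k ω) (G₂ k ω)).1‖ ^ 2 ∂μ ≤ T * σ ^ 2) :
    IsStationaryPairInExpectation μ ℓ Y f (4 * ε)
      (fun ω => ((T : ℝ)⁻¹ • ∑ k ∈ Finset.range T, W k ω).1)
      (fun ω => ((T : ℝ)⁻¹ • ∑ k ∈ Finset.range T, W k ω).2) := by
  have hT' : (0 : ℝ) < T := by exact_mod_cast hT
  set H : Ω → ℝ := fun ω => descentBudget f η x y (fun k => Z k ω) (fun k => W k ω)
    (fun k => G₁ k ω) (fun k => G₂ k ω) T with hH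
  set S : Ω → ℝ := fun ω => ‖∑ k ∈ Finset.range T, (gradNoise f (W k ω) (G₂ k ω)).1‖ ^ 2
  set a₀ := ‖a - x‖ ^ 2 + ‖y₀ - y‖ ^ 2 with ha₀
  have hD0 := hY.diam_nonneg
  -- The proximal point is within `D` of `a` because `2ℓ‖x - a‖ ≤ ε ≤ ℓD`.
  have ha₀D : a₀ ≤ 2 * D ^ 2 := by
    have h1 : 2 * ℓ * ‖a - x‖ ≤ ℓ * D := by rw [norm_sub_rev]; linarith
    have h2 : ‖a - x‖ ≤ D := by
      refine le_of_mul_le_mul_left ?_ hℓ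
      nlinarith [mul_nonneg hℓ.le (norm_nonneg (a - x))]
    have h3 := pow_le_pow_left₀ (norm_nonneg _) h2 2
    have h4 := pow_le_pow_left₀ (norm_nonneg _) (hY.norm_sub_le hy₀ hs.mem) 2
    linarith
  have hpt := fun ω => hs.extragradient_average_bounds h hℓ hY hη hηℓ
    (z := fun k => Z k ω) (w := fun k => W k ω) (g₁ := fun k => G₁ k ω) (g₂ := fun k => G₂ k ω)
    (fun k => hW k ω) (fun k => hZ k ω) hT ha
    (xb := ((T : ℝ)⁻¹ • ∑ k ∈ Finset.range T, W k ω).1)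
    (yb := ((T : ℝ)⁻¹ • ∑ k ∈ Finset.range T, W k ω).2)
    (by simp [Prod.fst_sum]) (by simp [Prod.snd_sum])
  simp only [hZ0, ← ha₀] at hpt
  set X : Ω → Euc m × Euc n := fun ω => (T : ℝ)⁻¹ • ∑ k ∈ Finset.range T, W k ω with hX
  have hXm : Measurable X := 
    (Finset.measurable_fun_sum (Finset.range T) fun k _ => hWm k).const_smul (T : ℝ)⁻¹
  have hHi : Integrable H μ := by
    simp only [hH, descentBudget, hZ0]
    exact ((integrable_const _).add ((integrable_finsetSum _ fun k _ =>
      (hV₁i k).add (hV₂i k)).const_mul _)).sub ((integrable_finsetSum _ fun k _ =>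
      hMi k).const_mul _)
  -- `2D²` from the start and `3η²·T·2σ² ≤ 12D²` from the noise; the linear noise terms have mean
  -- zero.
  have hHint : ∫ ω, H ω ∂μ ≤ 14 * D ^ 2 := by
    have e : ∫ ω, H ω ∂μ = a₀ + 3 * η ^ 2 * ∑ k ∈ Finset.range T,
        (∫ ω, gradNoiseSq f (Z k ω) (G₁ k ω) ∂μ + ∫ ω, gradNoiseSq f (W k ω) (G₂ k ω) ∂μ)
        - 2 * η * ∑ k ∈ Finset.range T, ∫ ω, gradNoiseInner f x y (W k ω) (G₂ k ω) ∂μ := by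
      simp only [hH, descentBudget, hZ0]
      rw [integral_sub, integral_add, integral_const, integral_const_mul, integral_const_mul,
        integral_finsetSum, integral_finsetSum]
      · simp only [integral_add (hV₁i _) (hV₂i _)]
        simp [ha₀]
      · exact fun k _ => hMi k
      · exact fun k _ => (hV₁i k).add (hV₂i k)
      · exact integrable_const _
      · exact (integrable_finsetSum _ fun k _ => (hV₁i k).add (hV₂i k)).const_mul _
      · exact (integrable_const _).add
          ((integrable_finsetSum _ fun k _ => (hV₁i k).add (hV₂i k)).const_mul _)
      · exact (integrable_finsetSum _ fun k _ => hMi k).const_mul _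
    have h1 : ∑ k ∈ Finset.range T, (∫ ω, gradNoiseSq f (Z k ω) (G₁ k ω) ∂μ
        + ∫ ω, gradNoiseSq f (W k ω) (G₂ k ω) ∂μ) ≤ T * (2 * σ ^ 2) := by
      refine (Finset.sum_le_card_nsmul _ _ (2 * σ ^ 2) fun k _ => ?_).trans (by simp)
      linarith [hV₁ k, hV₂ k]
    have h2 := mul_le_mul_of_nonneg_left h1 (by positivity : 0 ≤ 3 * η ^ 2)
    rw [e]
    simp only [hM, Finset.sum_const_zero]
    linarith
  have hρ : ℓ / (η * T) * D ^ 2 ≤ ε ^ 2 / 1000 := by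
    rw [div_mul_eq_mul_div, div_le_div_iff₀ (by positivity) (by norm_num)]
    refine le_of_mul_le_mul_left ?_ hℓ
    linarith
  have hρ0 : 0 ≤ ℓ / (η * T) := by positivity
  -- The square of the previous bound, divided by `(ℓD)² ≥ ε²`.
  have hτ : (1 / (η * T)) ^ 2 * D ^ 2 ≤ ε ^ 2 / 10 ^ 6 := by
    have h1 : (ℓ / (η * T) * D ^ 2) ^ 2 ≤ (ε ^ 2 / 1000) ^ 2 :=
      pow_le_pow_left₀ (by positivity) hρ 2
    have h2 : ε ^ 2 ≤ (ℓ * D) ^ 2 := pow_le_pow_left₀ hε.le hD 2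
    have h3 : (ℓ / (η * T) * D ^ 2) ^ 2 = (1 / (η * T)) ^ 2 * D ^ 2 * (ℓ * D) ^ 2 := by ring
    have h4 : (1 / (η * T)) ^ 2 * D ^ 2 * ε ^ 2 ≤ ε ^ 2 / 10 ^ 6 * ε ^ 2 := by
      have h5 := mul_le_mul_of_nonneg_left h2 (by positivity : 0 ≤ (1 / (η * T)) ^ 2 * D ^ 2)
      linarith
    exact le_of_mul_le_mul_right h4 (by positivity)
  have hSb : (1 / (T : ℝ)) ^ 2 * ∫ ω, S ω ∂μ ≤ ε ^ 2 / 10 ^ 6 := by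
    refine (mul_le_mul_of_nonneg_left hS (by positivity)).trans ?_
    have e : (1 / (T : ℝ)) ^ 2 * (T * σ ^ 2) = σ ^ 2 / T := by field_simp
    rw [e, div_le_div_iff₀ hT' (by norm_num)]
    linarith
  have hHρ : ℓ / (η * T) * ∫ ω, H ω ∂μ ≤ 14 * (ε ^ 2 / 1000) := by
    have := mul_le_mul_of_nonneg_left hHint hρ0
    linarith
  have hHτ : (1 / (η * T)) ^ 2 * (∫ ω, H ω ∂μ + a₀) ≤ 16 * (ε ^ 2 / 10 ^ 6) := by
    have := mul_le_mul_of_nonneg_left (add_le_add hHint ha₀D) (sq_nonneg (1 / (η * T)))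
    linarith
  have hasc : Measurable fun ω => ascentStep ℓ Y f (X ω).1 (X ω).2 := by
    have h1 : Measurable fun ω => gradY f (X ω).1 (X ω).2 :=
      (h.continuous_gradY hℓ.le).measurable.comp hXm
    exact hY.continuous_projSet.measurable.comp (hXm.snd.add (h1.const_smul (1 / ℓ)))
  have hgm : Measurable fun ω => gradX f (X ω).1 (ascentStep ℓ Y f (X ω).1 (X ω).2) :=
    (h.continuous_gradX hℓ.le).measurable.comp (hXm.fst.prodMk hasc)
  refine ⟨fun ω => (hpt ω).1, ?_, ?_⟩
  · have hbi : Integrable (fun ω => 4 * (ε ^ 2 + 16 * (1 / (η * T)) ^ 2 * (H ω + a₀)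
        + 8 * (1 / (T : ℝ)) ^ 2 * S ω + 20 * (ℓ / (η * T)) * H ω)) μ :=
      ((((integrable_const _).add ((hHi.add (integrable_const _)).const_mul _)).add
        (hSi.const_mul _)).add (hHi.const_mul _)).const_mul _
    have hi : Integrable (fun ω => ‖gradX f (X ω).1 (ascentStep ℓ Y f (X ω).1 (X ω).2)‖ ^ 2) μ :=
      hbi.mono' (hgm.norm.pow_const 2).aestronglyMeasurable
        (Filter.Eventually.of_forall fun ω => by
          rw [Real.norm_of_nonneg (sq_nonneg _)]; exact (hpt ω).2.2)
    refine ⟨hi, (integral_mono hi hbi fun ω => (hpt ω).2.2).trans ?_⟩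
    have e : ∫ ω, 4 * (ε ^ 2 + 16 * (1 / (η * T)) ^ 2 * (H ω + a₀)
        + 8 * (1 / (T : ℝ)) ^ 2 * S ω + 20 * (ℓ / (η * T)) * H ω) ∂μ
        = 4 * (ε ^ 2 + 16 * (1 / (η * T)) ^ 2 * (∫ ω, H ω ∂μ + a₀)
        + 8 * (1 / (T : ℝ)) ^ 2 * ∫ ω, S ω ∂μ + 20 * (ℓ / (η * T)) * ∫ ω, H ω ∂μ) := by
      have i1 : Integrable (fun ω => 16 * (1 / (η * T)) ^ 2 * (H ω + a₀)) μ :=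
        (hHi.add (integrable_const _)).const_mul _
      have i2 : Integrable (fun ω => ε ^ 2 + 16 * (1 / (η * T)) ^ 2 * (H ω + a₀)) μ :=
        (integrable_const _).add i1
      have i3 : Integrable (fun ω => 8 * (1 / (T : ℝ)) ^ 2 * S ω) μ := hSi.const_mul _
      have i4 : Integrable (fun ω => ε ^ 2 + 16 * (1 / (η * T)) ^ 2 * (H ω + a₀)
        + 8 * (1 / (T : ℝ)) ^ 2 * S ω) μ := i2.add i3
      rw [integral_const_mul, integral_add i4 (hHi.const_mul _), integral_add i2 i3,
        integral_add (integrable_const _) i1, integral_const_mul, integral_const_mul,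
        integral_const_mul, integral_add hHi (integrable_const _)]
      simp
    rw [e]
    nlinarith
  · have hbi : Integrable (fun ω => 1 / ℓ ^ 2 * (2 * (ℓ / (η * T)) * H ω)) μ :=
      (hHi.const_mul _).const_mul _
    have hb : ∀ ω, ‖ascentStep ℓ Y f (X ω).1 (X ω).2 - (X ω).2‖ ^ 2
        ≤ 1 / ℓ ^ 2 * (2 * (ℓ / (η * T)) * H ω) := fun ω => by
      rw [one_div, le_inv_mul_iff₀ (by positivity)]
      exact (hpt ω).2.1
    have hi : Integrable (fun ω => ‖ascentStep ℓ Y f (X ω).1 (X ω).2 - (X ω).2‖ ^ 2) μ :=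
      hbi.mono' ((hasc.sub hXm.snd).norm.pow_const 2).aestronglyMeasurable
        (Filter.Eventually.of_forall fun ω => by
          rw [Real.norm_of_nonneg (sq_nonneg _)]; exact hb ω)
    refine ⟨hi, (integral_mono hi hbi hb).trans ?_⟩
    rw [integral_const_mul, integral_const_mul, div_pow, one_div, inv_mul_eq_div]
    refine div_le_div_of_nonneg_right ?_ (by positivity)
    nlinarith

end IsProxSaddle

end Average

/-! ### Independence of the next sample from the past. -/

section Independence

variable {Ω Ξ : Type*} [MeasurableSpace Ξ]

/-- The σ-algebra generated by the first `k` samples. -/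
abbrev pastSamples (ξ : ℕ → Ω → Ξ) (k : ℕ) : MeasurableSpace Ω :=
  ⨆ i ∈ Set.Iio k, MeasurableSpace.comap (ξ i) inferInstance

theorem pastSamples_mono (ξ : ℕ → Ω → Ξ) : Monotone (pastSamples ξ) := fun _ _ hjk =>
  biSup_mono fun _ hi => lt_of_lt_of_le hi hjk

theorem measurable_pastSamples (ξ : ℕ → Ω → Ξ) {j k : ℕ} (hjk : j < k) :
    Measurable[pastSamples ξ k] (ξ j) :=
  measurable_iff_comap_le.2 (le_biSup (fun i => MeasurableSpace.comap (ξ i) inferInstance)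
    (Set.mem_Iio.2 hjk))

variable [MeasurableSpace Ω]

theorem pastSamples_le {ξ : ℕ → Ω → Ξ} (hξ : ∀ k, Measurable (ξ k)) (k : ℕ) :
    pastSamples ξ k ≤ ‹MeasurableSpace Ω› :=
  iSup₂_le fun i _ => (hξ i).comap_le

variable {μ : Measure Ω}

/-- The indices below `k` and `{k}` are disjoint, so the σ-algebras that they generate are
independent; queries and accumulated noise are functions of the past. -/
theorem indepFun_of_measurable_pastSamples {ξ : ℕ → Ω → Ξ} (hξ : ∀ k, Measurable (ξ k))
    (hind : iIndepFun ξ μ) {β : Type*} [MeasurableSpace β] {φ : Ω → β} {k : ℕ}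
    (hφ : Measurable[pastSamples ξ k] φ) : IndepFun φ (ξ k) μ := by
  have h1 := indep_iSup_of_disjoint (fun i => (hξ i).comap_le) hind
    (S := Set.Iio k) (T := {k}) (by simp)
  rw [IndepFun_iff_Indep]
  refine indep_of_indep_of_le_left ?_ (measurable_iff_comap_le.1 hφ)
  simpa [pastSamples] using h1

variable [IsProbabilityMeasure μ] {P : Measure Ξ} {V : Type*} [MeasurableSpace V]

/-- The joint law is a product, so Fubini allows integrating over the fresh sample first, with the
query frozen. This replaces conditional expectations. -/
theorem map_prodMk_of_indepFun {u : Ω → V} {ξ : Ω → Ξ} (hu : Measurable u) (hξ : Measurable ξ)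
    (hP : μ.map ξ = P) (hind : IndepFun u ξ μ) :
    μ.map (fun ω => (u ω, ξ ω)) = (μ.map u).prod P := by
  rw [(indepFun_iff_map_prod_eq_prod_map_map hu.aemeasurable hξ.aemeasurable).1 hind, hP]

/-- A bound on the expectation given the past is a bound on the expectation. -/
theorem integrable_and_integral_le_of_indepFun {u : Ω → V} {ξ : Ω → Ξ} (hu : Measurable u)
    (hξ : Measurable ξ) (hP : μ.map ξ = P) (hind : IndepFun u ξ μ) {h : V → Ξ → ℝ} {c : ℝ}
    (hm : Measurable fun p : V × Ξ => h p.1 p.2) (h0 : ∀ v s, 0 ≤ h v s)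
    (hi : ∀ v, Integrable (h v) P) (hc : ∀ v, ∫ s, h v s ∂P ≤ c) :
    Integrable (fun ω => h (u ω) (ξ ω)) μ ∧ ∫ ω, h (u ω) (ξ ω) ∂μ ≤ c := by
  have : IsProbabilityMeasure P := hP ▸ Measure.isProbabilityMeasure_map hξ.aemeasurable
  have : IsProbabilityMeasure (μ.map u) := Measure.isProbabilityMeasure_map hu.aemeasurable
  have hpair : Measurable fun ω => (u ω, ξ ω) := hu.prodMk hξ
  have hmap := map_prodMk_of_indepFun hu hξ hP hind
  have hmi : StronglyMeasurable fun v => ∫ s, h v s ∂P :=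
    hm.stronglyMeasurable.integral_prod_right
  have hinner : Integrable (fun v => ∫ s, h v s ∂P) (μ.map u) :=
    Integrable.of_bound hmi.aestronglyMeasurable c (Filter.Eventually.of_forall fun v => by
      rw [Real.norm_of_nonneg (integral_nonneg (h0 v))]; exact hc v)
  have hprod : Integrable (fun p : V × Ξ => h p.1 p.2) ((μ.map u).prod P) := by
    rw [integrable_prod_iff hm.aestronglyMeasurable]
    refine ⟨Filter.Eventually.of_forall hi, ?_⟩
    simpa only [Real.norm_of_nonneg (h0 _ _)] using hinner
  constructor
  · rw [← hmap] at hprod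
    exact hprod.comp_measurable hpair
  · have e : ∫ ω, h (u ω) (ξ ω) ∂μ = ∫ p, h p.1 p.2 ∂(μ.map fun ω => (u ω, ξ ω)) :=
      (integral_map hpair.aemeasurable hm.aestronglyMeasurable).symm
    rw [e, hmap, integral_prod _ hprod]
    refine (integral_mono hinner (integrable_const c) hc).trans ?_
    simp

/-- A centered error is orthogonal to the past. -/
theorem integral_inner_eq_zero_of_indepFun {E : Type*} [NormedAddCommGroup E]
    [InnerProductSpace ℝ E] [CompleteSpace E] [MeasurableSpace E] [BorelSpace E]
    [SecondCountableTopology E] {u : Ω → V} {v : Ω → E} {ξ : Ω → Ξ} (hu : Measurable u)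
    (hv : Measurable v) (hξ : Measurable ξ) (hP : μ.map ξ = P)
    (hind : IndepFun (fun ω => (u ω, v ω)) ξ μ) {ν : V → Ξ → E}
    (hm : Measurable fun p : V × Ξ => ν p.1 p.2) (hi : ∀ z, Integrable (ν z) P)
    (h0 : ∀ z, ∫ s, ν z s ∂P = 0) (hν2 : Integrable (fun ω => ‖ν (u ω) (ξ ω)‖ ^ 2) μ)
    (hv2 : Integrable (fun ω => ‖v ω‖ ^ 2) μ) :
    Integrable (fun ω => inner ℝ (ν (u ω) (ξ ω)) (v ω)) μ ∧
      ∫ ω, inner ℝ (ν (u ω) (ξ ω)) (v ω) ∂μ = 0 := by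
  have : IsProbabilityMeasure P := hP ▸ Measure.isProbabilityMeasure_map hξ.aemeasurable
  have huv : Measurable fun ω => (u ω, v ω) := hu.prodMk hv
  have : IsProbabilityMeasure (μ.map fun ω => (u ω, v ω)) :=
    Measure.isProbabilityMeasure_map huv.aemeasurable
  have hpair : Measurable fun ω => ((u ω, v ω), ξ ω) := huv.prodMk hξ
  have hmap := map_prodMk_of_indepFun huv hξ hP hind
  have hgm : Measurable fun p : (V × E) × Ξ => (inner ℝ (ν p.1.1 p.2) p.1.2 : ℝ) := by
    have h1 : Measurable fun p : (V × E) × Ξ => ν p.1.1 p.2 :=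
      hm.comp (measurable_fst.fst.prodMk measurable_snd)
    exact h1.inner measurable_fst.snd
  -- Square integrability of both factors serves only here, to justify Fubini.
  have hint : Integrable (fun ω => (inner ℝ (ν (u ω) (ξ ω)) (v ω) : ℝ)) μ := by
    refine (hν2.add hv2).mono' (hgm.comp hpair).aestronglyMeasurable
      (Filter.Eventually.of_forall fun ω => ?_)
    refine (abs_real_inner_le_norm _ _).trans ?_
    simp only [Pi.add_apply]
    nlinarith [sq_nonneg (‖ν (u ω) (ξ ω)‖ - ‖v ω‖), sq_nonneg (‖ν (u ω) (ξ ω)‖ + ‖v ω‖)]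
  refine ⟨hint, ?_⟩
  have e : ∫ ω, inner ℝ (ν (u ω) (ξ ω)) (v ω) ∂μ
      = ∫ p, inner ℝ (ν p.1.1 p.2) p.1.2 ∂(μ.map fun ω => ((u ω, v ω), ξ ω)) :=
    (integral_map hpair.aemeasurable hgm.aestronglyMeasurable).symm
  have hprod : Integrable (fun p : (V × E) × Ξ => (inner ℝ (ν p.1.1 p.2) p.1.2 : ℝ))
      ((μ.map fun ω => (u ω, v ω)).prod P) := by
    rw [← hmap]
    exact (integrable_map_measure hgm.aestronglyMeasurable hpair.aemeasurable).2 hint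
  rw [e, hmap, integral_prod _ hprod]
  have hz : ∀ p : V × E, ∫ s, (inner ℝ (ν p.1 s) p.2 : ℝ) ∂P = 0 := fun p => by
    simp only [real_inner_comm p.2]
    rw [integral_inner (hi p.1), h0, inner_zero_right]
  simp [hz]

end Independence

/-! ### Noise estimates along the run of the method. -/

section StochasticGradient

variable {m n : ℕ} {ℓ D σ : ℝ} {Y : Set (Euc n)} {f : Euc m → Euc n → ℝ}
  {Ω Ξ : Type*} [MeasurableSpace Ω] [MeasurableSpace Ξ] {μ : Measure Ω} {P : Measure Ξ}
  {G : Euc m × Euc n → Ξ → Euc m × Euc n}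

namespace IsStochasticGradient

theorem measurable_gradNoise (hG : IsStochasticGradient P σ f G) (h : IsSmoothConcave ℓ Y f)
    (hℓ : 0 ≤ ℓ) :
    Measurable fun p : (Euc m × Euc n) × Ξ => gradNoise f p.1 (G p.1 p.2) :=
  hG.measurable.sub (((h.continuous_gradX hℓ).measurable.prodMk
    (h.continuous_gradY hℓ).measurable).comp measurable_fst)

theorem integral_gradNoise [IsProbabilityMeasure P] (hG : IsStochasticGradient P σ f G)
    (z : Euc m × Euc n) : Integrable (fun s => gradNoise f z (G z s)) P ∧
      ∫ s, gradNoise f z (G z s) ∂P = 0 := by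
  refine ⟨(hG.integrable z).sub (integrable_const _), ?_⟩
  simp only [gradNoise]
  rw [integral_sub (hG.integrable z) (integrable_const _), hG.unbiased]
  simp

variable [IsProbabilityMeasure μ]

theorem gradNoiseSq_bound (hG : IsStochasticGradient P σ f G) (h : IsSmoothConcave ℓ Y f)
    (hℓ : 0 ≤ ℓ) {u : Ω → Euc m × Euc n} {ξ : Ω → Ξ} (hu : Measurable u) (hξ : Measurable ξ)
    (hP : μ.map ξ = P) (hind : IndepFun u ξ μ) :
    Integrable (fun ω => gradNoiseSq f (u ω) (G (u ω) (ξ ω))) μ ∧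
      ∫ ω, gradNoiseSq f (u ω) (G (u ω) (ξ ω)) ∂μ ≤ σ ^ 2 := by
  have hN := hG.measurable_gradNoise h hℓ
  exact integrable_and_integral_le_of_indepFun hu hξ hP hind
    (h := fun z s => gradNoiseSq f z (G z s))
    ((hN.fst.norm.pow_const 2).add (hN.snd.norm.pow_const 2))
    (fun _ _ => add_nonneg (sq_nonneg _) (sq_nonneg _)) hG.sq_integrable hG.variance_le

theorem integrable_sq_gradNoise (hG : IsStochasticGradient P σ f G) (h : IsSmoothConcave ℓ Y f)
    (hℓ : 0 ≤ ℓ) {u : Ω → Euc m × Euc n} {ξ : Ω → Ξ} (hu : Measurable u) (hξ : Measurable ξ)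
    (hP : μ.map ξ = P) (hind : IndepFun u ξ μ) :
    Integrable (fun ω => ‖(gradNoise f (u ω) (G (u ω) (ξ ω))).1‖ ^ 2) μ ∧
    Integrable (fun ω => ‖(gradNoise f (u ω) (G (u ω) (ξ ω))).2‖ ^ 2) μ := by
  have hN : Measurable fun ω => gradNoise f (u ω) (G (u ω) (ξ ω)) :=
    (hG.measurable_gradNoise h hℓ).comp (hu.prodMk hξ)
  have hi := (hG.gradNoiseSq_bound h hℓ hu hξ hP hind).1
  constructor
  · refine hi.mono' (hN.fst.norm.pow_const 2).aestronglyMeasurable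
      (Filter.Eventually.of_forall fun ω => ?_)
    rw [Real.norm_of_nonneg (sq_nonneg _)]
    exact le_add_of_nonneg_right (sq_nonneg _)
  · refine hi.mono' (hN.snd.norm.pow_const 2).aestronglyMeasurable
      (Filter.Eventually.of_forall fun ω => ?_)
    rw [Real.norm_of_nonneg (sq_nonneg _)]
    exact le_add_of_nonneg_left (sq_nonneg _)

theorem integral_inner_gradNoise_fst (hG : IsStochasticGradient P σ f G)
    (h : IsSmoothConcave ℓ Y f) (hℓ : 0 ≤ ℓ) {u : Ω → Euc m × Euc n} {v : Ω → Euc m}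
    {ξ : Ω → Ξ} (hu : Measurable u) (hv : Measurable v) (hξ : Measurable ξ) (hP : μ.map ξ = P)
    (hind : IndepFun (fun ω => (u ω, v ω)) ξ μ) (hv2 : Integrable (fun ω => ‖v ω‖ ^ 2) μ) :
    Integrable (fun ω => inner ℝ (gradNoise f (u ω) (G (u ω) (ξ ω))).1 (v ω)) μ ∧
      ∫ ω, inner ℝ (gradNoise f (u ω) (G (u ω) (ξ ω))).1 (v ω) ∂μ = 0 := by
  have : IsProbabilityMeasure P := hP ▸ Measure.isProbabilityMeasure_map hξ.aemeasurable
  refine integral_inner_eq_zero_of_indepFun hu hv hξ hP hind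
    (ν := fun z s => (gradNoise f z (G z s)).1) (hG.measurable_gradNoise h hℓ).fst
    (fun z => (hG.integral_gradNoise z).1.fst) (fun z => ?_)
    (hG.integrable_sq_gradNoise h hℓ hu hξ hP (hind.comp measurable_fst measurable_id)).1 hv2
  rw [← fst_integral (hG.integral_gradNoise z).1, (hG.integral_gradNoise z).2]; rfl

theorem integral_inner_gradNoise_snd (hG : IsStochasticGradient P σ f G)
    (h : IsSmoothConcave ℓ Y f) (hℓ : 0 ≤ ℓ) {u : Ω → Euc m × Euc n} {v : Ω → Euc n}
    {ξ : Ω → Ξ} (hu : Measurable u) (hv : Measurable v) (hξ : Measurable ξ) (hP : μ.map ξ = P)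
    (hind : IndepFun (fun ω => (u ω, v ω)) ξ μ) (hv2 : Integrable (fun ω => ‖v ω‖ ^ 2) μ) :
    Integrable (fun ω => inner ℝ (gradNoise f (u ω) (G (u ω) (ξ ω))).2 (v ω)) μ ∧
      ∫ ω, inner ℝ (gradNoise f (u ω) (G (u ω) (ξ ω))).2 (v ω) ∂μ = 0 := by
  have : IsProbabilityMeasure P := hP ▸ Measure.isProbabilityMeasure_map hξ.aemeasurable
  refine integral_inner_eq_zero_of_indepFun hu hv hξ hP hind
    (ν := fun z s => (gradNoise f z (G z s)).2) (hG.measurable_gradNoise h hℓ).snd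
    (fun z => (hG.integral_gradNoise z).1.snd) (fun z => ?_)
    (hG.integrable_sq_gradNoise h hℓ hu hξ hP (hind.comp measurable_fst measurable_id)).2 hv2
  rw [← snd_integral (hG.integral_gradNoise z).1, (hG.integral_gradNoise z).2]; rfl

/-- A stochastic gradient step preserves square integrability. -/
theorem memLp_proxStep_fst (hG : IsStochasticGradient P σ f G) (h : IsSmoothConcave ℓ Y f)
    (hℓ : 0 ≤ ℓ) (hY : IsConstraintSet D Y) {η : ℝ} {a : Euc m} {z u : Ω → Euc m × Euc n}
    {ξ : Ω → Ξ} (hu : Measurable u) (hξ : Measurable ξ) (hP : μ.map ξ = P)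
    (hind : IndepFun u ξ μ) (hz : MemLp (fun ω => (z ω).1) 2 μ)
    (hu2 : MemLp (fun ω => (u ω).1) 2 μ) (huY : ∀ ω, (u ω).2 ∈ Y) :
    MemLp (fun ω => (proxStep ℓ η Y a (z ω) (u ω) (G (u ω) (ξ ω))).1) 2 μ := by
  have hN : Measurable fun ω => gradNoise f (u ω) (G (u ω) (ξ ω)) :=
    (hG.measurable_gradNoise h hℓ).comp (hu.prodMk hξ)
  have hN2 : MemLp (fun ω => (gradNoise f (u ω) (G (u ω) (ξ ω))).1) 2 μ :=
    (memLp_two_iff_integrable_sq_norm hN.fst.aestronglyMeasurable).2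
      (hG.integrable_sq_gradNoise h hℓ hu hξ hP hind).1
  obtain ⟨y, hy⟩ := hY.nonempty
  -- The gradient grows at most linearly in `x`, and `y` stays in a set of diameter `D`.
  have hg : MemLp (fun ω => gradX f (u ω).1 (u ω).2) 2 μ := by
    have hb₁ : MemLp (fun ω => ‖(u ω).1‖ + D) 2 μ := hu2.norm.add (memLp_const D)
    have hb₂ : MemLp (fun ω => ℓ * (‖(u ω).1‖ + D)) 2 μ := hb₁.const_mul ℓ
    have hb : MemLp (fun ω => ‖gradX f 0 y‖ + ℓ * (‖(u ω).1‖ + D)) 2 μ :=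
      (memLp_const ‖gradX f 0 y‖).add hb₂
    have hgm : Measurable fun ω => gradX f (u ω).1 (u ω).2 :=
      (h.continuous_gradX hℓ).measurable.comp hu
    refine hb.mono hgm.aestronglyMeasurable
      (Filter.Eventually.of_forall fun ω => ?_)
    have h1 := h.norm_gradX_sub_le hℓ (u ω).1 0 (u ω).2 y
    have h2 := norm_le_norm_sub_add (gradX f (u ω).1 (u ω).2) (gradX f 0 y)
    have h3 := mul_le_mul_of_nonneg_left (hY.norm_sub_le (huY ω) hy) hℓ
    rw [sub_zero] at h1
    refine le_trans ?_ (le_abs_self _)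
    linarith
  have hGs : MemLp (fun ω => (G (u ω) (ξ ω)).1) 2 μ := by
    refine (hN2.add hg).ae_eq (Filter.Eventually.of_forall fun ω => ?_)
    simp [gradNoise, gradPair]
  exact hz.sub ((hGs.add ((hu2.sub (memLp_const a)).const_smul (2 * ℓ))).const_smul η)

end IsStochasticGradient

variable [IsProbabilityMeasure μ]

/-- The state after `k` answers is a function of the first `k` samples. -/
theorem measurable_egState {Ω Ξ : Type*} [MeasurableSpace Ξ]
    {G : Euc m × Euc n → Ξ → Euc m × Euc n}
    (hG : Measurable fun p : (Euc m × Euc n) × Ξ => G p.1 p.2)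
    (hY : Measurable (projSet Y)) (ℓ η : ℝ) (a : Euc m) (y₀ : Euc n) (ξ : ℕ → Ω → Ξ) (k : ℕ) :
    Measurable[pastSamples ξ k] fun ω => egState ℓ η Y a y₀ (fun j z => G z (ξ j ω)) k := by
  induction k with
  | zero => exact @measurable_const _ _ _ (pastSamples ξ 0) _
  | succ k ih =>
    have h1 := ih.mono (pastSamples_mono ξ k.le_succ) le_rfl
    have h2 : Measurable[pastSamples ξ (k + 1)] fun ω =>
        G (egQuery k (egState ℓ η Y a y₀ (fun j z => G z (ξ j ω)) k)) (ξ k ω) :=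
      hG.comp (((measurable_egQuery k).comp h1).prodMk (measurable_pastSamples ξ k.lt_succ_self))
    exact (measurable_egUpdate (ℓ := ℓ) (η := η) (a := a) hY k).comp (h1.prodMk h2)

/-- The extragradient method with independent samples finds a point that is stationary in
expectation. -/
theorem egMethod_isStationaryPairInExpectation
    (h : IsSmoothConcave ℓ Y f) (hℓ : 0 < ℓ) (hY : IsConstraintSet D Y) {η : ℝ} (hη : 0 < η)
    (hηℓ : 30 * η ^ 2 * ℓ ^ 2 ≤ 1) {T : ℕ} (hT : 0 < T) {ε : ℝ} (hε : 0 < ε) {a : Euc m}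
    (ha : IsMoreauStationary ℓ (maxFun Y f) ε a) (hD : ε ≤ ℓ * D)
    (hηT : 1000 * (ℓ * D) ^ 2 ≤ η * T * (ℓ * ε ^ 2)) (hησ : η ^ 2 * T * σ ^ 2 ≤ 2 * D ^ 2)
    (hTσ : 10 ^ 6 * σ ^ 2 ≤ T * ε ^ 2) {y₀ : Euc n} (hy₀ : y₀ ∈ Y)
    (hG : IsStochasticGradient P σ f G) {ξ : ℕ → Ω → Ξ} (hξ : ∀ k, Measurable (ξ k))
    (hP : ∀ k, μ.map (ξ k) = P) (hind : iIndepFun ξ μ) :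
    IsStationaryPairInExpectation μ ℓ Y f (4 * ε)
      (fun ω => ((egMethod ℓ η Y a y₀ T).result (fun k z => G z (ξ k ω))).1)
      (fun ω => ((egMethod ℓ η Y a y₀ T).result (fun k z => G z (ξ k ω))).2) := by
  obtain ⟨x, y, hs⟩ := h.exists_isProxSaddle hℓ hY a
  rw [hs.isMoreauStationary_iff h hℓ hY] at ha
  have hPm := hY.continuous_projSet.measurable
  have hR := measurable_egState hG.measurable hPm ℓ η a y₀ ξ
  set R : ℕ → Ω → _ := fun k ω => egState ℓ η Y a y₀ (fun j z => G z (ξ j ω)) k with hRdef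
  set Z : ℕ → Ω → Euc m × Euc n := fun k ω => (R (2 * k) ω).1 with hZdef
  set W : ℕ → Ω → Euc m × Euc n := fun k ω => (R (2 * k + 1) ω).2.1 with hWdef
  have hle := fun k => pastSamples_le hξ k
  have hZp : ∀ k, Measurable[pastSamples ξ (2 * k)] (Z k) := fun k => (hR (2 * k)).fst
  have hWp : ∀ k, Measurable[pastSamples ξ (2 * k + 1)] (W k) := fun k =>
    (hR (2 * k + 1)).snd.fst
  have hZm : ∀ k, Measurable (Z k) := fun k => (hZp k).mono (hle _) le_rfl
  have hWm : ∀ k, Measurable (W k) := fun k => (hWp k).mono (hle _) le_rfl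
  have hZi : ∀ k, IndepFun (Z k) (ξ (2 * k)) μ := fun k =>
    indepFun_of_measurable_pastSamples hξ hind (hZp k)
  have hWi : ∀ k, IndepFun (W k) (ξ (2 * k + 1)) μ := fun k =>
    indepFun_of_measurable_pastSamples hξ hind (hWp k)
  have hW : ∀ k ω, W k ω = proxStep ℓ η Y a (Z k ω) (Z k ω) (G (Z k ω) (ξ (2 * k) ω)) :=
    fun k ω => by simp only [hWdef, hRdef, egState_odd]; rfl
  have hZ : ∀ k ω, Z (k + 1) ω
      = proxStep ℓ η Y a (Z k ω) (W k ω) (G (W k ω) (ξ (2 * k + 1) ω)) :=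
    fun k ω => by simp only [hZdef, hRdef, egState_even]; rfl
  have hWY : ∀ k ω, (W k ω).2 ∈ Y := fun k ω => by rw [hW]; exact hY.projSet_mem _
  have hZY : ∀ k ω, (Z k ω).2 ∈ Y := fun k ω => by
    cases k with
    | zero => exact hy₀
    | succ k => rw [hZ]; exact hY.projSet_mem _
  have hWL : ∀ k, MemLp (fun ω => (Z k ω).1) 2 μ → MemLp (fun ω => (W k ω).1) 2 μ := by
    intro k hk
    simp only [hW]
    exact hG.memLp_proxStep_fst h hℓ.le hY (hZm k) (hξ _) (hP _) (hZi k) hk hk (hZY k)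
  have hZL : ∀ k, MemLp (fun ω => (Z k ω).1) 2 μ := by
    intro k
    induction k with
    | zero => exact memLp_const a
    | succ k ih =>
      simp only [hZ]
      exact hG.memLp_proxStep_fst h hℓ.le hY (hWm k) (hξ _) (hP _) (hWi k) ih (hWL k ih) (hWY k)
  have hM1 := fun k => hG.integral_inner_gradNoise_fst h hℓ.le (hWm k)
    (v := fun ω => (W k ω).1 - x) ((hWm k).fst.sub_const x) (hξ (2 * k + 1)) (hP _)
    (indepFun_of_measurable_pastSamples hξ hind ((hWp k).prodMk ((hWp k).fst.sub_const x)))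
    (((hWL k (hZL k)).sub (memLp_const x)).integrable_norm_pow (by norm_num))
  have hM2 := fun k => hG.integral_inner_gradNoise_snd h hℓ.le (hWm k)
    (v := fun ω => (W k ω).2 - y) ((hWm k).snd.sub_const y) (hξ (2 * k + 1)) (hP _)
    (indepFun_of_measurable_pastSamples hξ hind ((hWp k).prodMk ((hWp k).snd.sub_const y)))
    (Integrable.of_bound (((hWm k).snd.sub_const y).norm.pow_const 2).aestronglyMeasurable (D ^ 2)
      (Filter.Eventually.of_forall fun ω => by
        rw [Real.norm_of_nonneg (sq_nonneg _)]
        exact pow_le_pow_left₀ (norm_nonneg _) (hY.norm_sub_le (hWY k ω) hs.mem) 2))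
  have hV₂ := fun k => hG.gradNoiseSq_bound h hℓ.le (hWm k) (hξ (2 * k + 1)) (hP _) (hWi k)
  have hNp : ∀ k, Measurable[pastSamples ξ (2 * k + 2)] fun ω =>
      gradNoise f (W k ω) (G (W k ω) (ξ (2 * k + 1) ω)) := fun k =>
    (hG.measurable_gradNoise h hℓ.le).comp
      (((hWp k).mono (pastSamples_mono ξ (Nat.le_succ _)) le_rfl).prodMk
        (measurable_pastSamples ξ (Nat.lt_succ_self _)))
  -- The noise at midpoint `k` uses sample `2k + 1`, so the sum over `k < K` depends on samples
  -- below `2K` only and is independent of sample `2K + 1`.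
  have hSp : ∀ K : ℕ, Measurable[pastSamples ξ (2 * K)] fun ω => ∑ k ∈ Finset.range K,
      (gradNoise f (W k ω) (G (W k ω) (ξ (2 * k + 1) ω))).1 := fun K =>
    Finset.measurable_fun_sum _ fun k hk => ((hNp k).mono (pastSamples_mono ξ (by
      have := Finset.mem_range.1 hk; omega)) le_rfl).fst
  -- Orthogonal increments: the new noise is uncorrelated with the sum so far, so second moments add
  -- up to at most `Kσ²` instead of growing like `K²σ²`.
  have hS : ∀ K : ℕ, Integrable (fun ω => ‖∑ k ∈ Finset.range K,
      (gradNoise f (W k ω) (G (W k ω) (ξ (2 * k + 1) ω))).1‖ ^ 2) μ ∧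
      ∫ ω, ‖∑ k ∈ Finset.range K, (gradNoise f (W k ω) (G (W k ω) (ξ (2 * k + 1) ω))).1‖ ^ 2 ∂μ
        ≤ K * σ ^ 2 := by
    intro K
    induction K with
    | zero => simp
    | succ K ih =>
      have hSp' := (hSp K).mono (pastSamples_mono ξ (Nat.le_succ (2 * K))) le_rfl
      obtain ⟨hc, hc0⟩ := hG.integral_inner_gradNoise_fst h hℓ.le (hWm K)
        ((hSp K).mono (hle _) le_rfl) (hξ (2 * K + 1)) (hP _)
        (indepFun_of_measurable_pastSamples hξ hind ((hWp K).prodMk hSp')) ih.1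
      have hn := (hG.integrable_sq_gradNoise h hℓ.le (hWm K) (hξ (2 * K + 1)) (hP _) (hWi K)).1
      have hn' : ∫ ω, ‖(gradNoise f (W K ω) (G (W K ω) (ξ (2 * K + 1) ω))).1‖ ^ 2 ∂μ ≤ σ ^ 2 :=
        (integral_mono hn (hV₂ K).1 fun ω => le_add_of_nonneg_right (sq_nonneg _)).trans (hV₂ K).2
      have e : ∀ ω, ‖∑ k ∈ Finset.range (K + 1),
          (gradNoise f (W k ω) (G (W k ω) (ξ (2 * k + 1) ω))).1‖ ^ 2 =
          ‖∑ k ∈ Finset.range K, (gradNoise f (W k ω) (G (W k ω) (ξ (2 * k + 1) ω))).1‖ ^ 2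
          + 2 * inner ℝ (gradNoise f (W K ω) (G (W K ω) (ξ (2 * K + 1) ω))).1
            (∑ k ∈ Finset.range K, (gradNoise f (W k ω) (G (W k ω) (ξ (2 * k + 1) ω))).1)
          + ‖(gradNoise f (W K ω) (G (W K ω) (ξ (2 * K + 1) ω))).1‖ ^ 2 := fun ω => by
        rw [Finset.sum_range_succ, norm_add_sq_real, real_inner_comm]
      simp only [e]
      have hi : Integrable (fun ω => ‖∑ k ∈ Finset.range K,
          (gradNoise f (W k ω) (G (W k ω) (ξ (2 * k + 1) ω))).1‖ ^ 2
          + 2 * inner ℝ (gradNoise f (W K ω) (G (W K ω) (ξ (2 * K + 1) ω))).1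
            (∑ k ∈ Finset.range K, (gradNoise f (W k ω) (G (W k ω) (ξ (2 * k + 1) ω))).1)) μ :=
        ih.1.add (hc.const_mul 2)
      refine ⟨hi.add hn, ?_⟩
      rw [integral_add hi hn, integral_add ih.1 (hc.const_mul 2), integral_const_mul, hc0]
      push_cast
      linarith [ih.2]
  have hV₁ := fun k => hG.gradNoiseSq_bound h hℓ.le (hZm k) (hξ (2 * k)) (hP _) (hZi k)
  simp only [egMethod_result]
  exact hs.isStationaryPairInExpectation_average h hℓ hY hη hηℓ hT hε ha hD hηT hησ hTσ hy₀
    (Z := Z) (W := W) (G₁ := fun k ω => G (Z k ω) (ξ (2 * k) ω))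
    (G₂ := fun k ω => G (W k ω) (ξ (2 * k + 1) ω)) (fun ω => rfl) hW hZ hWm
    (fun k => (hV₁ k).1) (fun k => (hV₁ k).2) (fun k => (hV₂ k).1) (fun k => (hV₂ k).2)
    (fun k => (hM1 k).1.sub (hM2 k).1)
    (fun k => by
      simp only [gradNoiseInner]
      rw [integral_sub (hM1 k).1 (hM2 k).1, (hM1 k).2, (hM2 k).2, sub_zero])
    (hS T).1 (hS T).2

end StochasticGradient

/-! ### Choice of the parameters and conclusion. -/

/-- One method, from the stationary points of `Φ` to those of `f`, for all noise levels. -/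
theorem exists_measurable_method {m n : ℕ} {ℓ D σ ε : ℝ} (hℓ : 0 < ℓ) {Y : Set (Euc n)}
    (hY : IsConstraintSet D Y) (hε : 0 < ε) (a : Euc m) :
    ∃ N : ℕ, (N : ℝ) ≤ 4 * 10 ^ 6 * ((ℓ * D) ^ 2 / ε ^ 2) * (1 + σ ^ 2 / ε ^ 2) ∧
      (N : ℝ) ≤ 4 * 10 ^ 6 * ((ℓ * D) ^ 2 / ε ^ 2) * ((ℓ * D) ^ 2 / ε ^ 2 + σ ^ 2 / ε ^ 2) ∧
      ∃ A : OracleMethod (Euc m × Euc n) N, A.IsMeasurable ∧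
        ∀ f : Euc m → Euc n → ℝ, IsSmoothConcave ℓ Y f →
          IsMoreauStationary ℓ (maxFun Y f) ε a →
          ∀ (Ξ : Type*) [MeasurableSpace Ξ] (P : Measure Ξ)
            (G : Euc m × Euc n → Ξ → Euc m × Euc n), IsStochasticGradient P σ f G →
          ∀ (Ω : Type*) [MeasurableSpace Ω] (μ : Measure Ω) [IsProbabilityMeasure μ]
            (ξ : ℕ → Ω → Ξ), (∀ k, Measurable (ξ k)) → (∀ k, μ.map (ξ k) = P) →
            iIndepFun ξ μ →
            IsStationaryPairInExpectation μ ℓ Y f (4 * ε)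
              (fun ω => (A.result (fun k z => G z (ξ k ω))).1)
              (fun ω => (A.result (fun k z => G z (ξ k ω))).2) := by
  obtain ⟨y₀, hy₀⟩ := hY.nonempty
  rcases lt_or_ge (ℓ * D) ε with hD | hD
  · refine ⟨0, by rw [Nat.cast_zero]; positivity, by rw [Nat.cast_zero]; positivity,
      ⟨fun _ _ => (a, y₀), fun _ => (a, y₀)⟩, ⟨fun _ => measurable_const, measurable_const⟩, ?_⟩
    intro f h ha Ξ _ P G hG Ω _ μ _ ξ _ _ _
    obtain ⟨h1, h2, h3⟩ := h.isStationaryPair_of_diam_le hℓ hY hD.le hε ha hy₀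
    simp only [IsStationaryPairInExpectation, OracleMethod.result]
    refine ⟨fun _ => h1, ⟨integrable_const _, ?_⟩, ⟨integrable_const _, ?_⟩⟩
    · simpa using pow_le_pow_left₀ (norm_nonneg _) h2 2
    · simpa using pow_le_pow_left₀ (norm_nonneg _) h3 2
  · set r := (ℓ * D) ^ 2 / ε ^ 2 with hr
    set q := 1 + σ ^ 2 / ε ^ 2 with hq
    have hr1 : 1 ≤ r := by
      rw [hr, one_le_div (by positivity)]
      exact pow_le_pow_left₀ hε.le hD 2
    have hs0 : 0 ≤ σ ^ 2 / ε ^ 2 := by positivity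
    have hq1 : 1 ≤ q := by linarith
    have hrq : 1 ≤ r * q := one_le_mul_of_one_le_of_one_le hr1 hq1
    have hrε : r * ε ^ 2 = (ℓ * D) ^ 2 := div_mul_cancel₀ _ (by positivity)
    have hqε : σ ^ 2 ≤ q * ε ^ 2 := by
      rw [hq, add_mul, div_mul_cancel₀ _ (by positivity)]
      linarith [sq_nonneg ε]
    -- With `η = 1/(1000ℓq)`, the product `ηT` is at least `1000r/ℓ`, as the descent requires, while
    -- `η²T` is at most `2r/(ℓ²q)`, so the noise costs at most `2D²`. As `rq ≥ 1`, rounding up at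
    -- most doubles `T`.
    set T := ⌈10 ^ 6 * (r * q)⌉₊ with hT
    have hT1 : 10 ^ 6 * (r * q) ≤ T := Nat.le_ceil _
    have hT2 : (T : ℝ) ≤ 2 * 10 ^ 6 * (r * q) := by
      have := Nat.ceil_lt_add_one (by positivity : (0 : ℝ) ≤ 10 ^ 6 * (r * q))
      rw [← hT] at this
      linarith
    have hT0 : 0 < T := by
      have : (0 : ℝ) < T := by linarith
      exact_mod_cast this
    have hN : ((2 * T : ℕ) : ℝ) ≤ 4 * 10 ^ 6 * r * q := by
      push_cast
      linarith
    refine ⟨2 * T, hN, hN.trans ?_, egMethod ℓ (1 / (1000 * ℓ * q)) Y a y₀ T,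
      egMethod_isMeasurable hY.continuous_projSet.measurable T, ?_⟩
    -- `q ≤ r + σ²/ε²` because `r ≥ 1`. The sharper bound with `q` is what gives order `ε⁻²` for
    -- exact gradients.
    · exact mul_le_mul_of_nonneg_left (by linarith) (by positivity)
    intro f h ha Ξ _ P G hG Ω _ μ _ ξ hξ hP hind
    refine egMethod_isStationaryPairInExpectation h hℓ hY (by positivity) ?_ hT0 hε ha hD
      ?_ ?_ ?_ hy₀ hG hξ hP hind
    · have e : 30 * (1 / (1000 * ℓ * q)) ^ 2 * ℓ ^ 2 = 30 / (10 ^ 6 * q ^ 2) := by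
        field_simp; norm_num
      rw [e, div_le_one (by positivity)]
      nlinarith
    · have e : 1 / (1000 * ℓ * q) * T * (ℓ * ε ^ 2) = T * ε ^ 2 / (1000 * q) := by
        field_simp
      rw [e, le_div_iff₀ (by positivity), ← hrε]
      have := mul_le_mul_of_nonneg_right hT1 (sq_nonneg ε)
      linarith
    · have e : (1 / (1000 * ℓ * q)) ^ 2 * T * σ ^ 2 = T * σ ^ 2 / (10 ^ 6 * ℓ ^ 2 * q ^ 2) := by
        field_simp; ring
      rw [e, div_le_iff₀ (by positivity)]
      have h1 := mul_le_mul hT2 hqε (sq_nonneg σ) (by positivity)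
      have e2 : 2 * 10 ^ 6 * (r * q) * (q * ε ^ 2) = 2 * 10 ^ 6 * q ^ 2 * (r * ε ^ 2) := by ring
      rw [e2, hrε] at h1
      linarith
    · have h1 := mul_le_mul_of_nonneg_right hT1 (sq_nonneg ε)
      have h2 : q ≤ r * q := le_mul_of_one_le_left (by linarith) hr1
      have h3 := mul_le_mul_of_nonneg_right h2 (sq_nonneg ε)
      linarith

/-- Makes the exact oracle an instance of the stochastic one, so that a single method and a single
analysis serve both parts. -/
theorem isStochasticGradient_exact {m n : ℕ} (f : Euc m → Euc n → ℝ) {ℓ : ℝ} (hℓ : 0 ≤ ℓ)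
    {Y : Set (Euc n)} (h : IsSmoothConcave ℓ Y f) :
    IsStochasticGradient (Measure.dirac ()) 0 f (fun z _ => gradPair f z) where
  measurable := ((h.continuous_gradX hℓ).measurable.prodMk
    (h.continuous_gradY hℓ).measurable).comp measurable_fst
  integrable _ := integrable_const _
  unbiased _ := by simp
  sq_integrable _ := integrable_const _
  variance_le _ := by simp [gradPair]

theorem iIndepFun_dirac_unit : iIndepFun (fun (_ : ℕ) (u : Unit) => u) (Measure.dirac ()) := by
  rw [iIndepFun_iff_measure_inter_preimage_eq_mul]
  intro S sets _
  by_cases hS : ∀ i ∈ S, () ∈ sets i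
  · have h1 : () ∈ ⋂ i ∈ S, sets i := Set.mem_iInter₂.2 hS
    rw [Finset.prod_eq_one fun i hi => by simp [Set.indicator_of_mem (hS i hi)]]
    simp [Set.indicator_of_mem h1]
  · push Not at hS
    obtain ⟨i, hi, hn⟩ := hS
    rw [Finset.prod_eq_zero hi (by simpa [Set.indicator_apply] using hn)]
    simpa [Set.indicator_apply] using ⟨i, hi, hn⟩

theorem mainTheorem5 :
    -- from `Φ` to `f`, exact gradients
    (∃ K : ℝ, ∀ (m n : ℕ) (ℓ D : ℝ), 0 < ℓ → ∀ Y : Set (Euc n), IsConstraintSet D Y →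
      ∀ ε : ℝ, 0 < ε → ∀ xhat : Euc m,
        ∃ N : ℕ, (N : ℝ) ≤ K * (ℓ * D) ^ 2 / ε ^ 2 ∧
        ∃ A : OracleMethod (Euc m × Euc n) N,
          ∀ f : Euc m → Euc n → ℝ, IsSmoothConcave ℓ Y f →
            IsMoreauStationary ℓ (maxFun Y f) ε xhat →
            IsStationaryPair ℓ Y f (4 * ε)
              (A.result (fun _ => gradPair f)).1 (A.result (fun _ => gradPair f)).2) ∧
    -- from `Φ` to `f`, stochastic gradients
    (∃ K : ℝ, ∀ (m n : ℕ) (ℓ D σ : ℝ), 0 < ℓ → 0 ≤ σ →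
      ∀ Y : Set (Euc n), IsConstraintSet D Y →
      ∀ ε : ℝ, 0 < ε → ∀ xhat : Euc m,
        ∃ N : ℕ, (N : ℝ) ≤ K * ((ℓ * D) ^ 2 * ((ℓ * D) ^ 2 + σ ^ 2)) / ε ^ 4 ∧
        ∃ A : OracleMethod (Euc m × Euc n) N, A.IsMeasurable ∧
          ∀ f : Euc m → Euc n → ℝ, IsSmoothConcave ℓ Y f →
            IsMoreauStationary ℓ (maxFun Y f) ε xhat →
            ∀ (Ξ : Type*) [MeasurableSpace Ξ] (P : Measure Ξ)
              (G : Euc m × Euc n → Ξ → Euc m × Euc n), IsStochasticGradient P σ f G →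
            ∀ (Ω : Type*) [MeasurableSpace Ω] (μ : Measure Ω) [IsProbabilityMeasure μ]
              (ξ : ℕ → Ω → Ξ), (∀ k, Measurable (ξ k)) → (∀ k, μ.map (ξ k) = P) →
              iIndepFun ξ μ →
              IsStationaryPairInExpectation μ ℓ Y f (4 * ε)
                (fun ω => (A.result (fun k z => G z (ξ k ω))).1)
                (fun ω => (A.result (fun k z => G z (ξ k ω))).2)) ∧
    -- from `f` to `Φ`
    (∀ (m n : ℕ) (ℓ D : ℝ), 0 < ℓ → ∀ Y : Set (Euc n), IsConstraintSet D Y →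
      ∀ f : Euc m → Euc n → ℝ, IsSmoothConcave ℓ Y f →
      ∀ ε : ℝ, 0 ≤ ε → ∀ (xhat : Euc m) (yhat : Euc n),
        IsStationaryPair ℓ Y f (ε ^ 2 / max 1 (ℓ * D)) xhat yhat →
        IsMoreauStationary ℓ (maxFun Y f) (4 * ε ^ 2 + 4 * ε) xhat) := by
  refine ⟨⟨4 * 10 ^ 6, ?_⟩, ⟨4 * 10 ^ 6, ?_⟩, ?_⟩
  · intro m n ℓ D hℓ Y hY ε hε a
    obtain ⟨N, hN, -, A, -, hA⟩ := exists_measurable_method (σ := 0) hℓ hY hε a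
    refine ⟨N, hN.trans (le_of_eq ?_), A, fun f h ha => ?_⟩
    · simp [mul_div_assoc]
    obtain ⟨h1, ⟨-, h2⟩, -, h3⟩ := hA f h ha Unit _ _ (isStochasticGradient_exact f hℓ.le h)
      Unit (Measure.dirac ()) (fun _ u => u) (fun _ => measurable_id) (fun _ => Measure.map_id)
      iIndepFun_dirac_unit
    -- On a one-point space the mean square is the square itself, so the bounds in expectation hold
    -- pointwise.
    rw [integral_dirac] at h2 h3
    exact ⟨h1 (), (abs_le_of_sq_le_sq' h2 (by positivity)).2,
      (abs_le_of_sq_le_sq' h3 (by positivity)).2⟩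
  · intro m n ℓ D σ hℓ _ Y hY ε hε a
    obtain ⟨N, -, hN, A, hAm, hA⟩ := exists_measurable_method (σ := σ) hℓ hY hε a
    refine ⟨N, hN.trans (le_of_eq ?_), A, hAm, hA⟩
    field_simp
  · intro m n ℓ D hℓ Y hY f h ε hε a b hs
    exact isMoreauStationary_of_isStationaryPair h hℓ hY hε hs
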